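/- Let $V$ be a finite-dimensional complex vector space with a nondegenerate symmetric bilinear form $(\cdot,\cdot)$, and assume $\dim V\neq 2$. Write $\mathfrak{so}(V)$ for its orthogonal Lie algebra; it embeds into the even Clifford algebra $Cl^0(V)$ (with $vw+wv=2(v,w)$), the rotation $u\mapsto (w,u)v-(v,u)w$ corresponding to $\tfrac14(vw-wv)$. A spinor representation of $\mathfrak{so}(V)$ is an irreducible representation obtained by restricting a $Cl^0(V)$-module. A SUSY data over $V$ is a pair $(S,\Gamma)$, where $S$ is a finite-dimensional representation of $\mathfrak{so}(V)$ that is a sum of spinor representations, and $\Gamma\colon S\times S\to V$ is a symmetric, $\mathfrak{so}(V)$-equivariant bilinear map with $\{a\in S:\Gamma(a,x)=0\text{ for all }x\in S\}=0$. It is called irreducible if $S\neq0$ and it is not a direct sum $(S_1,\Gamma_1)\oplus(S_2,\Gamma_2)$ of two nonzero SUSY data. It satisfies the Fierz identity if for all $a,b,c,d\in S$ $$(\Gamma(a,b),\Gamma(c,d))+(\Gamma(a,c),\Gamma(b,d))+(\Gamma(a,d),\Gamma(b,c))=0,$$ that is, in an orthonormal basis of $V$ and a basis of $S$, $\Gamma^i_{\alpha\beta}\Gamma^i_{\gamma\delta}+\Gamma^i_{\alpha\gamma}\Gamma^i_{\beta\delta}+\Gamma^i_{\alpha\delta}\Gamma^i_{\beta\gamma}=0$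 (summation over $i$). Proposition. If a SUSY data $(S,\Gamma)$ over $V$ with $S\neq0$ satisfies the Fierz identity, then it is irreducible and $\dim V\in\{3,4,6,10\}$. Conversely, if $\dim V\in\{3,4,6,10\}$, then there is a SUSY data $(S,\Gamma)$ over $V$ with $S\neq 0$ that satisfies the Fierz identity. -/

import Mathlib

attribute [local instance 100] LieRing.ofAssociativeRing

namespace SUSY

section

variable {V : Type*} [AddCommGroup V] [Module ℂ V]

/-- The complex orthogonal Lie algebra `so(V)` of a bilinear form `B` on `V`:
the endomorphisms `X` with `B (X u) w = - B u (X w)`. -/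
abbrev so (B : LinearMap.BilinForm ℂ V) : LieSubalgebra ℂ (Module.End ℂ V) :=
  skewAdjointLieSubalgebra B

/-- The elementary rotation `v ∧ w ∈ so(V)`, that is `u ↦ (w, u) v - (v, u) w`. For a
nondegenerate form on a finite-dimensional space these elements span `so(V)`. -/
def wedge (B : LinearMap.BilinForm ℂ V) (hB : B.IsSymm) (v w : V) : so B :=
  ⟨(B w).smulRight v - (B v).smulRight w, by
    refine (LinearMap.mem_skewAdjointSubmodule (B := B) _).2 ?_
    intro x y
    simp [hB.eq x v, hB.eq x w]
    ring⟩

/-- The quadratic form `v ↦ (v, v)`. In its Clifford algebra `v w + w v = 2 (v, w)`. -/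
abbrev quad (B : LinearMap.BilinForm ℂ V) : QuadraticForm ℂ V :=
  LinearMap.BilinMap.toQuadraticMap B


/-- A representation `S` of `so(V)` is a *spinor representation* if it is irreducible and is the
restriction of a module over the even Clifford algebra along the spin embedding
`so(V) → Cl⁰(V)`, `v ∧ w ↦ (v w - w v) / 4`. (For `dim V` odd there is one such representation up
to isomorphism, for `dim V > 0` even there are the two half-spin representations.) -/
structure IsSpinorRep (B : LinearMap.BilinForm ℂ V) (hB : B.IsSymm) (S : Type*)
    [AddCommGroup S] [Module ℂ S] [LieRingModule (so B) S] [LieModule ℂ (so B) S] : Prop where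
  irreducible : LieModule.IsIrreducible ℂ (so B) S
  exists_clifford : ∃ ρ : CliffordAlgebra.even (quad B) →ₐ[ℂ] Module.End ℂ S,
    ∀ (v w : V) (s : S),
      ⁅wedge B hB v w, s⁆ =
        (4 : ℂ)⁻¹ • ρ ((CliffordAlgebra.even.ι (quad B)).bilin v w -
          (CliffordAlgebra.even.ι (quad B)).bilin w v) s


/-- `(S, Γ)` is a *SUSY data* over `(V, B)`: the finite-dimensional `so(V)`-module `S` is a sum of
spinor representations, and `Γ : S × S → V` is bilinear, symmetric, `so(V)`-equivariant and
has zero kernel. -/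
structure IsSUSYData (B : LinearMap.BilinForm ℂ V) (hB : B.IsSymm)
    {S : Type*} [AddCommGroup S] [Module ℂ S] [LieRingModule (so B) S] [LieModule ℂ (so B) S]
    (Γ : S →ₗ[ℂ] S →ₗ[ℂ] V) : Prop where
  finiteDimensional : FiniteDimensional ℂ S
  sum_of_spinors : sSup {N : LieSubmodule ℂ (so B) S | IsSpinorRep B hB N} = ⊤
  symm : ∀ a b : S, Γ a b = Γ b a
  equivariant : ∀ (X : so B) (a b : S),
    (X : Module.End ℂ V) (Γ a b) = Γ ⁅X, a⁆ b + Γ a ⁅X, b⁆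
  ker_eq_zero : ∀ a : S, (∀ b : S, Γ a b = 0) → a = 0

/-- The Fierz identity. In an orthonormal basis of `V` and any basis of `S` it reads
`Γ^i_{αβ} Γ^i_{γδ} + Γ^i_{αγ} Γ^i_{βδ} + Γ^i_{αδ} Γ^i_{βγ} = 0`. -/
def FierzIdentity (B : LinearMap.BilinForm ℂ V) {S : Type*} [AddCommGroup S] [Module ℂ S]
    (Γ : S →ₗ[ℂ] S →ₗ[ℂ] V) : Prop :=
  ∀ a b c d : S,
    B (Γ a b) (Γ c d) + B (Γ a c) (Γ b d) + B (Γ a d) (Γ b c) = 0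

/-- `(S, Γ)` is *irreducible*: it is nonzero, and it is not a direct sum
`(S₁, Γ₁) ⊕ (S₂, Γ₂) = (S₁ ⊕ S₂, Γ₁ + Γ₂)` of two nonzero ones. (If `S` is the direct
sum of two submodules with `Γ(S₁, S₂) = 0`, the restrictions of a SUSY data to `S₁` and `S₂` are
again SUSY data.) -/
structure IsIrreducibleData (B : LinearMap.BilinForm ℂ V)
    {S : Type*} [AddCommGroup S] [Module ℂ S] [LieRingModule (so B) S] [LieModule ℂ (so B) S]
    (Γ : S →ₗ[ℂ] S →ₗ[ℂ] V) : Prop where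
  nontrivial : Nontrivial S
  indecomposable : ∀ S₁ S₂ : LieSubmodule ℂ (so B) S, IsCompl S₁ S₂ →
    (∀ a ∈ S₁, ∀ b ∈ S₂, Γ a b = 0) → S₁ = ⊥ ∨ S₂ = ⊥

end

end SUSY

namespace SUSY

/-! Write `D = dim V`. Dimensions at most 1 die because Fierz makes every `Γ(a, a)` isotropic. For
`D ≥ 3`, fix an orthonormal basis `e` and an index `o`, and let `A i` be the action of `e_o e_i ∈
Cl⁰(V)`: `A o = 1`, the others are anticommuting square roots of `-1`. Equivariance forces `(e_i,
Γ(a, b)) = g(A i a, b)` with `g = (e_o, Γ)` nondegenerate, so Fierz becomes a statement about `g`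
and the `A i` (`IsFierzFamily`).

Stripping one argument and taking a trace over another gives `dim S = 2(D - 2)` (`finrank_eq`).
Clifford modules satisfy `2 ^ ⌊(D - 1) / 2⌋ ∣ dim S` (`two_pow_dvd_finrank`), and the two leave only
`3, 4, 6, 10`. For an orthogonal splitting, sign changes in the Fierz identity isolate `(2 - D) g(a,
c) b = 0` for `a, c` in one part and `b` in the other, hence irreducibility
(`eq_zero_of_orthogonal`).

Conversely `D = 2 ^ m + 2` with `m ≤ 3`, and a composition algebra `K` of dimension `2 ^ m` yields
gamma matrices on `S = K ⊕ K`. On the diagonal, Fierz reads `(|x|² + |y|²)² - (|x|² - |y|²)² -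
4|xy|² = 0`, which is multiplicativity of the norm. The matrices are unitary, so `S` is completely
reducible and hence a sum of spinor representations. -/

theorem exists_orthonormal_basis {V : Type*} [AddCommGroup V] [Module ℂ V] [FiniteDimensional ℂ V]
    {B : LinearMap.BilinForm ℂ V} (hsymm : B.IsSymm) (hnondeg : B.Nondegenerate)
    {ι : Type*} [Fintype ι] [DecidableEq ι] (hι : Fintype.card ι = Module.finrank ℂ V) :
    ∃ e : Module.Basis ι ℂ V, ∀ i j, B (e i) (e j) = if i = j then 1 else 0 := by
  obtain ⟨v, hv⟩ := LinearMap.BilinForm.exists_orthogonal_basis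
    (LinearMap.BilinForm.isSymm_iff.1 hsymm)
  have hne : ∀ i, B (v i) (v i) ≠ 0 := fun i =>
    LinearMap.IsOrthoᵢ.not_isOrtho_basis_self_of_separatingLeft hv hnondeg.1 i
  choose r hr using fun i => IsAlgClosed.exists_pow_nat_eq (B (v i) (v i)) (n := 2) (by norm_num)
  have hr0 : ∀ i, r i ≠ 0 := fun i h => hne i (by rw [← hr i, h]; norm_num)
  let w := v.isUnitSMul (w := fun i => (r i)⁻¹) (fun i => (inv_ne_zero (hr0 i)).isUnit)
  have hw : ∀ i j, B (w i) (w j) = if i = j then 1 else 0 := by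
    intro i j
    simp only [w, Module.Basis.isUnitSMul_apply, map_smul, LinearMap.smul_apply, smul_eq_mul]
    split_ifs with h
    · subst h
      rw [← hr i]
      have := hr0 i
      field_simp
    · have : B (v i) (v j) = 0 := hv h
      rw [this]
      simp
  let f : Fin (Module.finrank ℂ V) ≃ ι := (Fintype.equivFinOfCardEq hι).symm
  refine ⟨w.reindex f, fun i j => ?_⟩
  simp [hw]

/-! ### Dimensions of Clifford modules, and the arithmetic of `D`. -/

/-- Two complementary eigenspaces swapped by an invertible operator have half the dimension. -/
theorem finrank_eq_two_mul_ker {S : Type*} [AddCommGroup S] [Module ℂ S] [FiniteDimensional ℂ S]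
    (P A : Module.End ℂ S) (hP : P * P = -1) (hA : A * A = -1) (hAP : A * P = -(P * A)) :
    Module.finrank ℂ S
      = 2 * Module.finrank ℂ (LinearMap.ker (P - Complex.I • (1 : Module.End ℂ S))) := by
  have hP' : ∀ x, P (P x) = -x := fun x => by simpa using LinearMap.congr_fun hP x
  have hA' : ∀ x, A (A x) = -x := fun x => by simpa using LinearMap.congr_fun hA x
  have hAP' : ∀ x, A (P x) = -P (A x) := fun x => by simpa using LinearMap.congr_fun hAP x
  have hI : Complex.I * Complex.I = -1 := Complex.I_mul_I
  set K := LinearMap.ker (P - Complex.I • (1 : Module.End ℂ S)) with hK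
  have memK : ∀ x, x ∈ K ↔ P x = Complex.I • x := fun x => by
    simp [hK, LinearMap.mem_ker, sub_eq_zero]
  set M := LinearMap.ker (P + Complex.I • (1 : Module.End ℂ S)) with hM
  have memM : ∀ x, x ∈ M ↔ P x = -(Complex.I • x) := fun x => by
    simp [hM, LinearMap.mem_ker, add_eq_zero_iff_eq_neg]
  have hcompl : IsCompl K M := by
    refine ⟨Submodule.disjoint_def.2 fun x h1 h2 => ?_, codisjoint_iff.2 (eq_top_iff.2 fun x _ => ?_)⟩
    · rw [memK] at h1
      rw [memM, h1] at h2
      have : (2 * Complex.I) • x = 0 := by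
        rw [two_mul, add_smul]; nth_rewrite 1 [h2]; simp
      simpa using this
    -- As `P² = -1`, the operators `(1 ∓ iP) / 2` are the projections onto the `±i` eigenspaces.
    · refine Submodule.mem_sup.2 ⟨(2⁻¹ : ℂ) • (x - Complex.I • P x), ?_,
        (2⁻¹ : ℂ) • (x + Complex.I • P x), ?_, ?_⟩
      · rw [memK]
        simp only [map_smul, map_sub, hP', smul_sub, smul_smul, smul_neg]
        match_scalars <;> first | linear_combination (2⁻¹ : ℂ) * hI | ring1
      · rw [memM]
        simp only [map_smul, map_add, hP', smul_add, smul_smul, smul_neg]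
        match_scalars <;> first | linear_combination (2⁻¹ : ℂ) * hI | ring1
      · module
  have hle : Module.finrank ℂ K ≤ Module.finrank ℂ M := by
    refine LinearMap.finrank_le_finrank_of_injective (f := A.restrict (p := K) (q := M) ?_) ?_
    · intro x hx
      rw [memK] at hx
      rw [memM, ← map_smul, ← hx, hAP', neg_neg]
    · intro x y hxy
      have : A x = A y := congrArg Subtype.val hxy
      have := congrArg A this
      rw [hA', hA'] at this
      exact Subtype.ext (neg_injective this)
  have hge : Module.finrank ℂ M ≤ Module.finrank ℂ K := by
    refine LinearMap.finrank_le_finrank_of_injective (f := A.restrict (p := M) (q := K) ?_) ?_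
    · intro x hx
      rw [memM] at hx
      rw [memK, ← map_smul, ← neg_eq_iff_eq_neg.2 hx, map_neg, hAP', neg_neg]
    · intro x y hxy
      have : A x = A y := congrArg Subtype.val hxy
      have := congrArg A this
      rw [hA', hA'] at this
      exact Subtype.ext (neg_injective this)
  have := Submodule.finrank_add_eq_of_isCompl hcompl
  omega

/-- A module over the Clifford algebra of `n` anticommuting square roots of `-1` has dimension
divisible by `2 ^ ⌊n / 2⌋`. -/
theorem two_pow_dvd_finrank : ∀ (n : ℕ) (S : Type*) [AddCommGroup S] [Module ℂ S]
    [FiniteDimensional ℂ S] (A : Fin n → Module.End ℂ S), (∀ i, A i * A i = -1) →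
    (∀ i j, i ≠ j → A i * A j = -(A j * A i)) → 2 ^ (n / 2) ∣ Module.finrank ℂ S
  | 0, _, _, _, _, _, _, _ => by simp
  | 1, _, _, _, _, _, _, _ => by simp
  | n + 2, S, _, _, _, A, hsq, hanti => by
    have h01 := hanti 0 1 (by simp)
    have h0 := hsq 0
    -- The product `P` of two generators squares to `-1` and `A 0` swaps its eigenspaces. The other
    -- `n` generators commute with `P`, so they act on the half-dimensional space `K`.
    have h1 := hsq 1
    set P := A 0 * A 1 with hPdef
    have hP : P * P = -1 := by
      calc P * P = A 0 * (A 1 * A 0) * A 1 := by simp only [hPdef, mul_assoc]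
        _ = -((A 0 * A 0) * (A 1 * A 1)) := by
          rw [← neg_eq_iff_eq_neg.2 h01]; simp only [hPdef, mul_assoc, mul_neg, neg_mul]
        _ = -1 := by rw [h0, h1]; simp
    have hAP : A 0 * P = -(P * A 0) := by
      conv_rhs => rw [h01]
      rw [neg_mul, neg_neg, mul_assoc, hPdef, ← mul_assoc, h0, mul_neg_one, neg_one_mul]
    rw [finrank_eq_two_mul_ker P (A 0) hP h0 hAP]
    set K := LinearMap.ker (P - Complex.I • (1 : Module.End ℂ S)) with hK
    have memK : ∀ x, x ∈ K ↔ P x = Complex.I • x := fun x => by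
      simp [hK, LinearMap.mem_ker, sub_eq_zero]
    have hcomm : ∀ i : Fin n, A i.succ.succ * P = P * A i.succ.succ := fun i => by
      have e0 := hanti i.succ.succ 0 (Fin.succ_ne_zero _)
      have e1 := hanti i.succ.succ 1 (by
        intro h; exact Fin.succ_ne_zero i (Fin.succ_injective _ (h.trans Fin.succ_zero_eq_one.symm)))
      rw [hPdef, ← mul_assoc, e0, neg_mul, mul_assoc, e1, mul_neg, neg_neg, mul_assoc]
    have hmaps : ∀ i : Fin n, ∀ x ∈ K, A i.succ.succ x ∈ K := fun i x hx => by
      rw [memK] at hx ⊢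
      have := LinearMap.congr_fun (hcomm i) x
      simp only [Module.End.mul_apply] at this
      rw [← this, hx, map_smul]
    have key := two_pow_dvd_finrank n K (fun i => (A i.succ.succ).restrict (hmaps i))
      (fun i => by
        ext x
        simpa using LinearMap.congr_fun (hsq i.succ.succ) x)
      (fun i j hij => by
        ext x
        simpa using LinearMap.congr_fun (hanti i.succ.succ j.succ.succ (by simpa using hij)) x)
    rw [show (n + 2) / 2 = n / 2 + 1 by omega, pow_succ, mul_comm]
    exact mul_dvd_mul_left 2 key

/-- Excludes `D = n + 11`: there `2(D - 2)` is smaller than its supposed divisor. Raising `n` by two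
doubles the right side and adds only 4 to the left. -/
theorem two_mul_lt_two_pow (n : ℕ) : 2 * (n + 9) < 2 ^ ((n + 10) / 2) := by
  induction n using Nat.strong_induction_on with
  | _ n ih =>
    match n with
    | 0 => norm_num
    | 1 => norm_num
    | n + 2 =>
      have := ih n (by omega)
      rw [show (n + 2 + 10) / 2 = (n + 10) / 2 + 1 by omega, pow_succ]
      omega

theorem dim_mem_of_two_pow_dvd {D : ℕ} (hD : 3 ≤ D) (h : 2 ^ ((D - 1) / 2) ∣ 2 * (D - 2)) :
    D ∈ ({3, 4, 6, 10} : Set ℕ) := by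
  rcases lt_or_ge D 11 with hlt | hge
  · interval_cases D <;> revert h <;> norm_num
  · obtain ⟨n, rfl⟩ := Nat.exists_eq_add_of_le hge
    have h1 := Nat.le_of_dvd (by omega) h
    have h2 := two_mul_lt_two_pow n
    rw [show 11 + n - 1 = n + 10 by omega] at h1
    omega

/-! ### The even Clifford action recovered from the Lie algebra action. -/

section Spinor

variable {V : Type*} [AddCommGroup V] [Module ℂ V] (B : LinearMap.BilinForm ℂ V) (hB : B.IsSymm)

/-- The action of the product `v w ∈ Cl⁰(V)` on an `so(V)`-module of spinors. -/
noncomputable def cliffordAct (S : Type*) [AddCommGroup S] [Module ℂ S] [LieRingModule (so B) S]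
    [LieModule ℂ (so B) S] (v w : V) : Module.End ℂ S :=
  (2 : ℂ) • LieModule.toEnd ℂ (so B) S (wedge B hB v w) + B v w • 1

variable {S : Type*} [AddCommGroup S] [Module ℂ S] [LieRingModule (so B) S]
    [LieModule ℂ (so B) S]

theorem cliffordAct_apply (v w : V) (s : S) :
    cliffordAct B hB S v w s = (2 : ℂ) • ⁅wedge B hB v w, s⁆ + B v w • s := by
  simp [cliffordAct]

theorem wedge_swap (v w : V) : wedge B hB v w = -wedge B hB w v := by
  ext u
  simp [wedge]

theorem cliffordAct_add_swap (v w : V) :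
    cliffordAct B hB S v w + cliffordAct B hB S w v = (2 * B v w) • 1 := by
  rw [cliffordAct, cliffordAct, wedge_swap B hB w v, map_neg, hB.eq w v]
  module

theorem even_bilin_add_swap {B : LinearMap.BilinForm ℂ V} (hB : B.IsSymm) (v w : V) :
    (CliffordAlgebra.even.ι (quad B)).bilin v w + (CliffordAlgebra.even.ι (quad B)).bilin w v
      = algebraMap ℂ _ (2 * B v w) := by
  have h := (CliffordAlgebra.even.ι (quad B)).contract (v + w)
  have hv := (CliffordAlgebra.even.ι (quad B)).contract v
  have hw := (CliffordAlgebra.even.ι (quad B)).contract w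
  have hq : quad B (v + w) = quad B v + quad B w + 2 * B v w := by
    simp [hB.eq w v]; ring
  rw [hq] at h
  simp only [map_add, LinearMap.add_apply, hv, hw] at h ⊢
  rw [← sub_eq_zero] at h ⊢
  rw [← h]
  abel

/-- In `Cl⁰(V)` one has `vw = 2 · (vw - wv) / 4 + (v, w)`, so the Lie action determines the action
of every product `vw`. -/
theorem IsSpinorRep.cliffordAct_eq (h : IsSpinorRep B hB S) :
    ∃ ρ : CliffordAlgebra.even (quad B) →ₐ[ℂ] Module.End ℂ S, ∀ v w,
      cliffordAct B hB S v w = ρ ((CliffordAlgebra.even.ι (quad B)).bilin v w) := by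
  obtain ⟨ρ, hρ⟩ := h.exists_clifford
  refine ⟨ρ, fun v w => LinearMap.ext fun s => ?_⟩
  have h2 := congrArg (fun x => ρ x s) (even_bilin_add_swap hB v w)
  simp only [map_add, LinearMap.add_apply, AlgHom.commutes, Module.algebraMap_end_apply] at h2
  rw [cliffordAct_apply, hρ, map_sub, LinearMap.sub_apply]
  have h3 : B v w • s = (2⁻¹ : ℂ) • ((2 * B v w) • s) := by module
  rw [h3, ← h2]
  module

theorem IsSpinorRep.cliffordAct_mul (h : IsSpinorRep B hB S) (u v w : V) :
    cliffordAct B hB S u v * cliffordAct B hB S v w = B v v • cliffordAct B hB S u w := by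
  obtain ⟨ρ, hρ⟩ := h.cliffordAct_eq
  rw [hρ, hρ, hρ, ← map_mul, (CliffordAlgebra.even.ι (quad B)).contract_mid, map_smul]
  rfl

/-- Each spinor summand has its own `ρ`, but `cliffordAct` is defined by the Lie action alone; the
relation therefore extends from the summands by linearity. -/
theorem cliffordAct_mul_of_sSup (h : sSup {N : LieSubmodule ℂ (so B) S | IsSpinorRep B hB N} = ⊤)
    (u v w : V) :
    cliffordAct B hB S u v * cliffordAct B hB S v w = B v v • cliffordAct B hB S u w := by
  refine LinearMap.ext fun s => ?_
  have hs : s ∈ sSup {N : LieSubmodule ℂ (so B) S | IsSpinorRep B hB N} := h ▸ LieSubmodule.mem_top s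
  rw [sSup_eq_iSup'] at hs
  induction hs using LieSubmodule.iSup_induction' with
  | mem N x hx =>
    have := congrArg Subtype.val
      (LinearMap.congr_fun (N.2.cliffordAct_mul B hB u v w) (⟨x, hx⟩ : N.1))
    simpa [cliffordAct_apply] using this
  | zero => simp
  | add x y hx hy ihx ihy => rw [map_add, map_add, ihx, ihy]

end Spinor

/-! ### Consequences of the Fierz identity: dimension count and indecomposability. -/

section Fierz

variable {S : Type*} [AddCommGroup S] [Module ℂ S] {ι : Type*} [Fintype ι]

/-- A family of symmetric operators `A i`, `i : ι`, relative to a nondegenerate symmetric form `g`,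
with `A o = 1` and the other ones anticommuting square roots of `-1`, whose bilinear forms
`g (A i a) b` satisfy the Fierz identity. -/
structure IsFierzFamily (g : LinearMap.BilinForm ℂ S) (A : ι → Module.End ℂ S) (o : ι) :
    Prop where
  base : A o = 1
  sq : ∀ i, i ≠ o → A i * A i = -1
  anti : ∀ i j, i ≠ o → j ≠ o → i ≠ j → A i * A j = -(A j * A i)
  symm : ∀ a b, g a b = g b a
  adj : ∀ i a b, g (A i a) b = g a (A i b)
  nondeg : ∀ a, (∀ b, g a b = 0) → a = 0
  fierz : ∀ a b c d, ∑ i, (g (A i a) b * g (A i c) d + g (A i a) c * g (A i b) d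
    + g (A i a) d * g (A i b) c) = 0

namespace IsFierzFamily

variable {g : LinearMap.BilinForm ℂ S} {A : ι → Module.End ℂ S} {o : ι}

theorem fierz_vector (h : IsFierzFamily g A o) (a b c : S) :
    ∑ i, (g (A i a) b • A i c + g (A i a) c • A i b + g (A i b) c • A i a) = 0 := by
  refine h.nondeg _ fun d => ?_
  rw [← h.fierz a b c d]
  simp only [map_sum, map_add, map_smul, LinearMap.sum_apply, LinearMap.add_apply,
    LinearMap.smul_apply, smul_eq_mul]
  exact Finset.sum_congr rfl fun i _ => by ring

variable [DecidableEq ι]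

/-- A third index `j ∉ {o, i}` exists, and conjugation by the invertible `A j` turns `A i` into `-A
i`. -/
theorem trace_eq_zero [FiniteDimensional ℂ S] (h : IsFierzFamily g A o)
    (hcard : 3 ≤ Fintype.card ι) {i : ι} (hi : i ≠ o) : LinearMap.trace ℂ S (A i) = 0 := by
  obtain ⟨j, hj⟩ : ∃ j, j ∉ ({o, i} : Finset ι) := by
    by_contra! hcon
    have := Finset.card_le_card (fun x _ => hcon x : Finset.univ ⊆ ({o, i} : Finset ι))
    have := Finset.card_le_two (a := o) (b := i)
    rw [← Finset.card_univ] at hcard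
    omega
  simp only [Finset.mem_insert, Finset.mem_singleton, not_or] at hj
  have h1 : LinearMap.trace ℂ S (A j * (A j * A i)) = - LinearMap.trace ℂ S (A i) := by
    rw [← mul_assoc, h.sq j hj.1]; simp
  have h2 : LinearMap.trace ℂ S (A j * (A j * A i)) = LinearMap.trace ℂ S (A i) := by
    rw [LinearMap.trace_mul_comm, h.anti j i hj.1 hi hj.2, neg_mul, mul_assoc, h.sq j hj.1]
    simp
  have : (2 : ℂ) * LinearMap.trace ℂ S (A i) = 0 := by linear_combination h1 - h2
  simpa using this

/-- The index `o` contributes `g a c` and each of the others `-g a c`, since `A i` is self-adjoint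
with square `-1`. -/
theorem sum_form_apply (h : IsFierzFamily g A o) (a c : S) :
    ∑ i, g (A i a) (A i c) = (2 - Fintype.card ι : ℂ) * g a c := by
  have : ∀ i, g (A i a) (A i c) = (if i = o then 2 * g a c else 0) - g a c := fun i => by
    split_ifs with hi
    · subst hi; rw [h.base]; simp; ring
    · rw [h.adj, ← Module.End.mul_apply, h.sq i hi]; simp
  simp only [this, Finset.sum_sub_distrib, Finset.sum_ite_eq', Finset.mem_univ, if_true,
    Finset.sum_const, Finset.card_univ, nsmul_eq_mul]
  ring

/-- View `fierz_vector` as an operator in `b` and take its trace: the outer terms give `2(2 - D)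
g(a, c)`, and in the middle only `A o = 1` has a trace, giving `dim S · g(a, c)`. -/
theorem finrank_eq [FiniteDimensional ℂ S] [Nontrivial S] (h : IsFierzFamily g A o)
    (hcard : 3 ≤ Fintype.card ι) : Module.finrank ℂ S = 2 * (Fintype.card ι - 2) := by
  obtain ⟨a, ha⟩ := exists_ne (0 : S)
  obtain ⟨c, hc⟩ : ∃ c, g a c ≠ 0 := by
    by_contra! hcon
    exact ha (h.nondeg a hcon)
  have hop : ∑ i, ((g (A i a)).smulRight (A i c) + g (A i a) c • A i
      + (g (A i c)).smulRight (A i a)) = 0 := by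
    refine LinearMap.ext fun b => ?_
    rw [LinearMap.zero_apply, ← h.fierz_vector a b c, LinearMap.sum_apply]
    refine Finset.sum_congr rfl fun i _ => ?_
    simp only [LinearMap.add_apply, LinearMap.smulRight_apply, LinearMap.smul_apply]
    rw [h.adj i c b, h.symm c]
  have htr := congrArg (LinearMap.trace ℂ S) hop
  have hmid : ∑ i, g (A i a) c * LinearMap.trace ℂ S (A i) = g a c * Module.finrank ℂ S := by
    rw [Finset.sum_eq_single o]
    · simp [h.base]
    · intro i _ hi
      rw [h.trace_eq_zero hcard hi, mul_zero]
    · simp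
  simp only [map_sum, map_add, map_smul, LinearMap.trace_smulRight, map_zero, smul_eq_mul,
    Finset.sum_add_distrib, h.sum_form_apply, hmid, h.symm c a] at htr
  have h0 : g a c * ((Module.finrank ℂ S : ℂ) - 2 * (Fintype.card ι - 2)) = 0 := by
    linear_combination htr
  have h1 := (mul_eq_zero.1 h0).resolve_left hc
  rw [sub_eq_zero] at h1
  zify [show 2 ≤ Fintype.card ι by omega]
  exact_mod_cast h1

theorem card_mem [FiniteDimensional ℂ S] [Nontrivial S] (h : IsFierzFamily g A o)
    (hcard : 3 ≤ Fintype.card ι) : Fintype.card ι ∈ ({3, 4, 6, 10} : Set ℕ) := by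
  refine dim_mem_of_two_pow_dvd hcard ?_
  rw [← h.finrank_eq hcard]
  have hc : Fintype.card {i // i ≠ o} = Fintype.card ι - 1 := by
    simp [Fintype.card_subtype_compl]
  let f := (Fintype.equivFinOfCardEq hc).symm
  exact two_pow_dvd_finrank _ S (fun i => A (f i)) (fun i => h.sq _ (f i).2)
    (fun i j hij => h.anti _ _ (f i).2 (f j).2 fun e => hij (f.injective (Subtype.ext e)))

/-- If `S₁` and `S₂` are orthogonal and stable under the operators, one of them vanishes. -/
theorem eq_zero_of_orthogonal (h : IsFierzFamily g A o) (hcard : 3 ≤ Fintype.card ι)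
    {S₁ S₂ : Submodule ℂ S} (hcompl : IsCompl S₁ S₂) (h₁ : ∀ i, ∀ a ∈ S₁, A i a ∈ S₁)
    (h₂ : ∀ i, ∀ a ∈ S₂, A i a ∈ S₂) (horth : ∀ a ∈ S₁, ∀ b ∈ S₂, g a b = 0) :
    S₁ = ⊥ ∨ S₂ = ⊥ := by
  by_contra! hcon
  obtain ⟨a, ha, ha0⟩ := Submodule.exists_mem_ne_zero_of_ne_bot hcon.1
  obtain ⟨b, hb, hb0⟩ := Submodule.exists_mem_ne_zero_of_ne_bot hcon.2
  obtain ⟨c, hc, hac⟩ : ∃ c ∈ S₁, g a c ≠ 0 := by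
    by_contra! hz
    refine ha0 (h.nondeg a fun x => ?_)
    obtain ⟨y, z, hy, hz', rfl⟩ := Submodule.codisjoint_iff_exists_add_eq.1 hcompl.codisjoint x
    rw [map_add, hz y hy, horth a ha z hz', add_zero]
  -- With `b ∈ S₂`, orthogonality kills two of the three Fierz terms.
  have hsum : ∀ x ∈ S₁, ∀ y ∈ S₁, ∑ i, g (A i x) y • A i b = 0 := fun x hx y hy => by
    rw [← h.fierz_vector x b y]
    refine Finset.sum_congr rfl fun i _ => ?_
    rw [horth _ (h₁ i x hx) b hb, h.symm (A i b), horth y hy _ (h₂ i b hb)]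
    simp
  set t : ι → S := fun i => g (A i a) c • A i b with ht
  have ht0 : ∑ i, t i = 0 := hsum a ha c hc
  -- Replace `(a, c)` by `(A k a, A k c)`. As `A k * A i * A k` is `-A i` for `i ∈ {o, k}` and `A i`
  -- otherwise, exactly `t o` and `t k` change sign; comparing the two sums gives `t o + t k = 0`.
  have hk : ∀ k, k ≠ o → t k = -t o := fun k hk => by
    have h1 := hsum (A k a) (h₁ k a ha) (A k c) (h₁ k c hc)
    have h2 : ∀ i, g (A i (A k a)) (A k c) • A i b
        = t i - (if i = o then (2 : ℂ) • t o else 0) - (if i = k then (2 : ℂ) • t k else 0) := by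
      intro i
      rw [← h.adj]
      rcases eq_or_ne i o with rfl | hi
      · have := LinearMap.congr_fun (h.sq k hk) a
        simp only [Module.End.mul_apply, LinearMap.neg_apply, Module.End.one_apply] at this
        simp only [ht, h.base, Module.End.one_apply, this, if_true, if_neg hk.symm, map_neg,
          LinearMap.neg_apply]
        module
      · rcases eq_or_ne i k with rfl | hik
        · have := LinearMap.congr_fun (h.sq i hi) (A i a)
          simp only [Module.End.mul_apply, LinearMap.neg_apply, Module.End.one_apply] at this
          simp only [ht, this, if_true, if_neg hi, map_neg, LinearMap.neg_apply]
          module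
        · have e1 := LinearMap.congr_fun (h.anti i k hi hk hik) a
          have e2 := LinearMap.congr_fun (h.sq k hk) (A i a)
          simp only [Module.End.mul_apply, LinearMap.neg_apply, Module.End.one_apply] at e1 e2
          simp only [ht, e1, e2, map_neg, neg_neg, if_neg hi, if_neg hik, sub_zero]
    simp only [h2, Finset.sum_sub_distrib, Finset.sum_ite_eq', Finset.mem_univ, if_true, ht0] at h1
    have h3 : t k = (-2⁻¹ : ℂ) • (0 - (2 : ℂ) • t o - (2 : ℂ) • t k) - t o := by module
    rw [h3, h1]; simp
  have hall : ∀ i, t i = (if i = o then (2 : ℂ) • t o else 0) - t o := fun i => by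
    split_ifs with hi
    · subst hi; module
    · rw [hk i hi]; simp
  -- The sum is now `(2 - D) • t o`, and `t o = g a c • b` is nonzero.
  rw [Finset.sum_congr rfl fun i _ => hall i] at ht0
  simp only [Finset.sum_sub_distrib, Finset.sum_ite_eq', Finset.mem_univ, if_true,
    Finset.sum_const, Finset.card_univ] at ht0
  rw [← Nat.cast_smul_eq_nsmul ℂ, ← sub_smul] at ht0
  have hne : (2 : ℂ) - Fintype.card ι ≠ 0 := by
    rw [sub_ne_zero]; norm_cast; omega
  have := (smul_eq_zero.1 ht0).resolve_left hne
  simp only [ht, h.base, Module.End.one_apply, smul_eq_zero] at this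
  tauto

end IsFierzFamily

end Fierz

/-! ### From SUSY data to Fierz families. -/

section Data

variable {V : Type*} [AddCommGroup V] [Module ℂ V] {B : LinearMap.BilinForm ℂ V} {hB : B.IsSymm}
  {S : Type*} [AddCommGroup S] [Module ℂ S] [LieRingModule (so B) S] [LieModule ℂ (so B) S]
  {Γ : S →ₗ[ℂ] S →ₗ[ℂ] V}

theorem IsSUSYData.cliffordAct_invariance (h : IsSUSYData B hB Γ) (u v w : V) (a b : S) :
    B u (Γ (cliffordAct B hB S v w a) b) + B u (Γ a (cliffordAct B hB S v w b))
      = 2 * (B w (Γ a b) * B u v - B v (Γ a b) * B u w) + 2 * B v w * B u (Γ a b) := by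
  have h1 := congrArg (B u) (h.equivariant (wedge B hB v w) a b)
  simp only [wedge, LinearMap.sub_apply, LinearMap.smulRight_apply, map_sub, map_smul,
    smul_eq_mul, map_add] at h1
  simp only [cliffordAct_apply, map_add, map_smul, LinearMap.add_apply, LinearMap.smul_apply,
    smul_eq_mul]
  simp only [wedge] at h1 ⊢
  linear_combination -2 * h1

variable {ι : Type*} [DecidableEq ι] {e : Module.Basis ι ℂ V}

theorem form_basis_eq_repr [Fintype ι] (he : ∀ i j, B (e i) (e j) = if i = j then 1 else 0)
    (i : ι) (z : V) : B (e i) z = e.repr z i := by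
  conv_lhs => rw [← e.sum_repr z]
  simp only [map_sum, map_smul, he, smul_eq_mul, mul_ite, mul_one, mul_zero, Finset.sum_ite_eq,
    Finset.mem_univ, if_true]

theorem sum_form_mul_form [Fintype ι] (he : ∀ i j, B (e i) (e j) = if i = j then 1 else 0)
    (x y : V) : ∑ i, B (e i) x * B (e i) y = B x y := by
  conv_rhs => rw [← e.sum_repr x]
  simp only [map_sum, map_smul, LinearMap.sum_apply, LinearMap.smul_apply, smul_eq_mul,
    form_basis_eq_repr he]

theorem eq_zero_of_form_basis_eq_zero [Fintype ι]
    (he : ∀ i j, B (e i) (e j) = if i = j then 1 else 0) {z : V} (hz : ∀ i, B (e i) z = 0) :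
    z = 0 :=
  e.ext_elem fun i => by rw [← form_basis_eq_repr he, hz, map_zero, Finsupp.zero_apply]

/-- Equivariance only controls the sum of the actions on `a` and on `b`. A third axis `e i`
separates them: combine the rotations `ij` on `(a, b)`, `ik` on `(e_k e_j a, b)` and `kj` on `(a,
e_i e_k b)`, all paired with `e i`; the last fixes `e i`, so its right side is zero. -/
theorem IsSUSYData.form_cliffordAct (h : IsSUSYData B hB Γ)
    (he : ∀ i j, B (e i) (e j) = if i = j then 1 else 0) {i j k : ι} (hij : i ≠ j) (hik : i ≠ k)
    (hjk : j ≠ k) (a b : S) :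
    B (e k) (Γ (cliffordAct B hB S (e k) (e j) a) b) = B (e j) (Γ a b) := by
  have hneg : ∀ p q, p ≠ q → ∀ x : S, cliffordAct B hB S (e p) (e q) x
      = -cliffordAct B hB S (e q) (e p) x := fun p q hpq x => by
    have := LinearMap.congr_fun (cliffordAct_add_swap (S := S) B hB (e p) (e q)) x
    rw [he, if_neg hpq] at this
    simpa [add_eq_zero_iff_eq_neg] using this
  have hmul : ∀ p q r, ∀ x : S, cliffordAct B hB S (e p) (e q) (cliffordAct B hB S (e q) (e r) x)
      = cliffordAct B hB S (e p) (e r) x := fun p q r x => by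
    have := LinearMap.congr_fun
      (cliffordAct_mul_of_sSup B hB h.sum_of_spinors (e p) (e q) (e r)) x
    simpa [he] using this
  have hkji : cliffordAct B hB S (e k) (e j) (cliffordAct B hB S (e i) (e k) b)
      = -cliffordAct B hB S (e i) (e j) b := by
    rw [hneg i k hik, map_neg, hneg k j hjk.symm, neg_neg, hmul, hneg j i hij.symm]
  have e1 := h.cliffordAct_invariance (e i) (e i) (e j) a b
  have e2 := h.cliffordAct_invariance (e i) (e i) (e k) (cliffordAct B hB S (e k) (e j) a) b
  have e3 := h.cliffordAct_invariance (e i) (e k) (e j) a (cliffordAct B hB S (e i) (e k) b)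
  rw [hkji] at e3
  rw [hmul] at e2
  simp only [he, hij, hik, hjk.symm, if_true, if_false, map_neg] at e1 e2 e3
  linear_combination (1 / 2) * (e1 - e2 + e3)

theorem IsSUSYData.isFierzFamily [Fintype ι] (h : IsSUSYData B hB Γ) (hF : FierzIdentity B Γ)
    (he : ∀ i j, B (e i) (e j) = if i = j then 1 else 0) (hcard : 3 ≤ Fintype.card ι) (o : ι) :
    IsFierzFamily (Γ.compr₂ (B (e o))) (fun i => cliffordAct B hB S (e o) (e i)) o := by
  have hneg : ∀ p q, p ≠ q → cliffordAct B hB S (e p) (e q)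
      = -cliffordAct B hB S (e q) (e p) := fun p q hpq => by
    have := cliffordAct_add_swap (S := S) B hB (e p) (e q)
    rw [he, if_neg hpq] at this
    simpa [add_eq_zero_iff_eq_neg] using this
  have hone : ∀ p, cliffordAct B hB S (e p) (e p) = 1 := fun p => by
    have := cliffordAct_add_swap (S := S) B hB (e p) (e p)
    rw [he, if_pos rfl, ← two_smul ℂ, mul_one] at this
    exact smul_right_injective _ two_ne_zero this
  have hmul : ∀ p q r, cliffordAct B hB S (e p) (e q) * (cliffordAct B hB S (e q) (e r))
      = cliffordAct B hB S (e p) (e r) := fun p q r => by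
    have := cliffordAct_mul_of_sSup B hB h.sum_of_spinors (e p) (e q) (e r)
    simpa [he] using this
  have hform : ∀ i (a b : S), B (e o) (Γ (cliffordAct B hB S (e o) (e i) a) b)
      = B (e i) (Γ a b) := fun i a b => by
    rcases eq_or_ne i o with rfl | hi
    · rw [hone]; rfl
    · obtain ⟨j, hj⟩ : ∃ j, j ∉ ({o, i} : Finset ι) := by
        by_contra! hcon
        have := Finset.card_le_card (fun x _ => hcon x : Finset.univ ⊆ ({o, i} : Finset ι))
        have := Finset.card_le_two (a := o) (b := i)
        rw [← Finset.card_univ] at hcard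
        omega
      simp only [Finset.mem_insert, Finset.mem_singleton, not_or] at hj
      exact h.form_cliffordAct he hj.2 hj.1 hi a b
  -- Self-adjointness is forced by the symmetry of `Γ`.
  have hadj : ∀ i (a b : S), B (e o) (Γ (cliffordAct B hB S (e o) (e i) a) b)
      = B (e o) (Γ a (cliffordAct B hB S (e o) (e i) b)) := fun i a b => by
    rw [h.symm a, hform, hform, h.symm a]
  refine ⟨hone o, fun i hi => ?_, fun i j hi hj hij => ?_, fun a b => ?_, hadj, fun a ha => ?_,
    fun a b c d => ?_⟩
  · rw [hneg o i hi.symm, neg_mul_neg, ← neg_inj, neg_neg]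
    nth_rewrite 1 [hneg i o hi]
    rw [neg_mul, neg_neg, hmul, hone]
  · have hprod : ∀ p q, p ≠ o → cliffordAct B hB S (e o) (e p) * cliffordAct B hB S (e o) (e q)
        = -cliffordAct B hB S (e p) (e q) := fun p q hp => by
      rw [hneg o p hp.symm, neg_mul, hmul]
    rw [hprod i j hi, hprod j i hj, hneg i j hij]
  · simp [h.symm a b]
  · refine h.ker_eq_zero a fun b => eq_zero_of_form_basis_eq_zero he fun i => ?_
    rw [← hform, hadj]
    exact ha _
  · have := hF a b c d
    rw [← sum_form_mul_form he, ← sum_form_mul_form he, ← sum_form_mul_form he,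
      ← Finset.sum_add_distrib, ← Finset.sum_add_distrib] at this
    simp only [LinearMap.compr₂_apply, hform]
    exact this

/-- In dimension at most one, the Fierz identity forces the spinors to vanish. -/
theorem IsSUSYData.three_le_finrank [FiniteDimensional ℂ V] [Nontrivial S]
    (hnondeg : B.Nondegenerate) (hdim : Module.finrank ℂ V ≠ 2) (h : IsSUSYData B hB Γ)
    (hF : FierzIdentity B Γ) : 3 ≤ Module.finrank ℂ V := by
  by_contra! hlt
  have hle : Module.finrank ℂ V ≤ 1 := by omega
  obtain ⟨v, hv⟩ := finrank_le_one_iff.1 hle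
  -- Four equal arguments make `Γ a a` isotropic, and a nondegenerate space of dimension at most one
  -- has no nonzero isotropic vector.
  have hzero : ∀ a, Γ a a = 0 := fun a => by
    have h1 : B (Γ a a) (Γ a a) = 0 := by
      have := hF a a a a
      linear_combination (1 / 3) * this
    obtain ⟨c, hc⟩ := hv (Γ a a)
    refine hnondeg.1 _ fun y => ?_
    obtain ⟨d, rfl⟩ := hv y
    rw [← hc] at h1 ⊢
    simp only [map_smul, LinearMap.smul_apply, smul_eq_mul, mul_eq_zero] at h1 ⊢
    tauto
  obtain ⟨a, ha⟩ := exists_ne (0 : S)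
  refine ha (h.ker_eq_zero a fun b => ?_)
  have h1 := hzero (a + b)
  simp only [map_add, LinearMap.add_apply, hzero, h.symm b a, zero_add, add_zero] at h1
  simpa [← two_smul ℂ] using h1

theorem IsSUSYData.irreducible_and_dim_mem [FiniteDimensional ℂ V] [Nontrivial S]
    (hnondeg : B.Nondegenerate) (hdim : Module.finrank ℂ V ≠ 2) (h : IsSUSYData B hB Γ)
    (hF : FierzIdentity B Γ) :
    IsIrreducibleData B Γ ∧ Module.finrank ℂ V ∈ ({3, 4, 6, 10} : Set ℕ) := by
  have h3 := h.three_le_finrank hnondeg hdim hF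
  obtain ⟨e, he⟩ := exists_orthonormal_basis hB hnondeg (ι := Fin (Module.finrank ℂ V)) (by simp)
  have hcard : 3 ≤ Fintype.card (Fin (Module.finrank ℂ V)) := by simpa using h3
  have hfam := h.isFierzFamily hF he hcard ⟨0, by omega⟩
  have := h.finiteDimensional
  refine ⟨⟨inferInstance, fun S₁ S₂ hcompl horth => ?_⟩, by simpa using hfam.card_mem hcard⟩
  have hmem : ∀ N : LieSubmodule ℂ (so B) S, ∀ v w, ∀ a ∈ N.toSubmodule,
      cliffordAct B hB S v w a ∈ N.toSubmodule := fun N v w a ha => by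
    rw [cliffordAct_apply]
    exact add_mem (N.smul_mem _ (N.lie_mem ha)) (N.smul_mem _ ha)
  simpa using hfam.eq_zero_of_orthogonal hcard (LieSubmodule.isCompl_toSubmodule.2 hcompl)
    (fun i => hmem S₁ _ _) (fun i => hmem S₂ _ _) fun a ha b hb => by simp [horth a ha b hb]

end Data

/-! ### Recognising sums of spinor representations. -/

section SpinorRep

variable {V : Type*} [AddCommGroup V] [Module ℂ V] {B : LinearMap.BilinForm ℂ V} {hB : B.IsSymm}
  {S : Type*} [AddCommGroup S] [Module ℂ S] [LieRingModule (so B) S]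

theorem isIrreducible_of_isAtom {N : LieSubmodule ℂ (so B) S} (hN : IsAtom N) :
    LieModule.IsIrreducible ℂ (so B) N := by
  have : Nontrivial N := (LieSubmodule.nontrivial_iff_ne_bot ..).2 hN.1
  refine LieModule.IsIrreducible.mk fun K hK => ?_
  have hle : K.map N.incl ≤ N := by
    rintro x hx
    obtain ⟨y, -, rfl⟩ := (LieSubmodule.mem_map x).1 hx
    exact y.2
  rcases hN.le_iff.1 hle with h | h
  · refine absurd ((LieSubmodule.eq_bot_iff _).2 fun x hx => ?_) hK
    have : N.incl x ∈ K.map N.incl := (LieSubmodule.mem_map _).2 ⟨x, hx, rfl⟩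
    rw [h, LieSubmodule.mem_bot] at this
    exact Subtype.ext this
  · refine eq_top_iff.2 fun x _ => ?_
    have : (x : S) ∈ K.map N.incl := by rw [h]; exact x.2
    obtain ⟨y, hy, hyx⟩ := (LieSubmodule.mem_map _).1 this
    rwa [← Subtype.ext hyx]

variable [LieModule ℂ (so B) S]

/-- The relation `hmul` is what the universal property of `Cl⁰(V)` needs; `v v = (v, v)` is
automatic because `v ∧ v = 0`. -/
theorem isSpinorRep_of_cliffordAct_mul (hirr : LieModule.IsIrreducible ℂ (so B) S)
    (hmul : ∀ u v w, cliffordAct B hB S u v * cliffordAct B hB S v w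
      = B v v • cliffordAct B hB S u w) : IsSpinorRep B hB S := by
  have hw₁ : ∀ u v w, wedge B hB (u + v) w = wedge B hB u w + wedge B hB v w := fun u v w => by
    ext x; simp [wedge]; module
  have hw₂ : ∀ (r : ℂ) u v, wedge B hB (r • u) v = r • wedge B hB u v := fun r u v => by
    ext x; simp [wedge]; module
  have hw₃ : ∀ u v w, wedge B hB u (v + w) = wedge B hB u v + wedge B hB u w := fun u v w => by
    ext x; simp [wedge]; module
  have hw₄ : ∀ (r : ℂ) u v, wedge B hB u (r • v) = r • wedge B hB u v := fun r u v => by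
    ext x; simp [wedge]; module
  let f : CliffordAlgebra.EvenHom (quad B) (Module.End ℂ S) :=
    { bilin := LinearMap.mk₂ ℂ (cliffordAct B hB S)
        (fun u v w => by
          simp only [cliffordAct, hw₁, map_add, LinearMap.add_apply]; module)
        (fun r u v => by
          simp only [cliffordAct, hw₂, map_smul, LinearMap.smul_apply, smul_eq_mul]; module)
        (fun u v w => by simp only [cliffordAct, hw₃, map_add]; module)
        (fun r u v => by simp only [cliffordAct, hw₄, map_smul, smul_eq_mul]; module)
      contract := fun v => by
        have := cliffordAct_add_swap (S := S) B hB v v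
        rw [← two_smul ℂ, mul_smul] at this
        exact (smul_right_injective _ two_ne_zero this).trans
          (Algebra.algebraMap_eq_smul_one _).symm
      contract_mid := fun u v w => hmul u v w }
  refine ⟨hirr, CliffordAlgebra.even.lift (quad B) f, fun v w s => ?_⟩
  rw [map_sub, CliffordAlgebra.even.lift_ι, CliffordAlgebra.even.lift_ι, LinearMap.sub_apply]
  change _ = (4 : ℂ)⁻¹ • (cliffordAct B hB S v w s - cliffordAct B hB S w v s)
  rw [cliffordAct_apply, cliffordAct_apply, wedge_swap B hB w v, neg_lie, hB.eq w v]
  module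

/-- Complete reducibility makes the module the supremum of its atoms, which are irreducible and
inherit `hmul`. -/
theorem sSup_isSpinorRep_eq_top [IsArtinian ℂ S] [ComplementedLattice (LieSubmodule ℂ (so B) S)]
    (hmul : ∀ u v w, cliffordAct B hB S u v * cliffordAct B hB S v w
      = B v v • cliffordAct B hB S u w) :
    sSup {N : LieSubmodule ℂ (so B) S | IsSpinorRep B hB N} = ⊤ := by
  have : IsAtomistic (LieSubmodule ℂ (so B) S) := inferInstance
  refine eq_top_iff.2 (sSup_atoms_eq_top.ge.trans (sSup_le_sSup fun N hN => ?_))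
  refine isSpinorRep_of_cliffordAct_mul (isIrreducible_of_isAtom hN) fun u v w => ?_
  ext s
  have := LinearMap.congr_fun (hmul u v w) s
  simpa [cliffordAct_apply] using this

end SpinorRep

/-! ### The spin representation attached to a Clifford pair. -/

section CliffordPair

variable {V : Type*} [AddCommGroup V] [Module ℂ V] {B : LinearMap.BilinForm ℂ V}
  {S : Type*} [AddCommGroup S] [Module ℂ S]

/-- A pair of linear maps `A, A' : V → End S` with `A' v * A v = A v * A' v = (v, v)`: the
off-diagonal blocks of a graded module `S ⊕ S` over the Clifford algebra. -/
structure IsCliffordPair (B : LinearMap.BilinForm ℂ V) (A A' : V →ₗ[ℂ] Module.End ℂ S) : Prop where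
  left : ∀ u v, A' u * A v + A' v * A u = (2 * B u v) • 1
  right : ∀ u v, A u * A' v + A v * A' u = (2 * B u v) • 1

variable {ι : Type*} [Fintype ι] (e : Module.Basis ι ℂ V)
  {A A' : V →ₗ[ℂ] Module.End ℂ S}

theorem IsCliffordPair.swap (h : IsCliffordPair B A A') : IsCliffordPair B A' A :=
  ⟨h.right, h.left⟩

/-- The spin action `X ↦ ¼ ∑ᵢ (X eᵢ) eᵢ` of an endomorphism of `V` in an orthonormal basis. -/
noncomputable def spinAction (A A' : V →ₗ[ℂ] Module.End ℂ S) :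
    Module.End ℂ V →ₗ[ℂ] Module.End ℂ S where
  toFun X := (4 : ℂ)⁻¹ • ∑ i, A' (X (e i)) * A (e i)
  map_add' X Y := by
    simp only [LinearMap.add_apply, map_add, add_mul, Finset.sum_add_distrib, smul_add]
  map_smul' r X := by
    simp only [LinearMap.smul_apply, map_smul, smul_mul_assoc, ← Finset.smul_sum, RingHom.id_apply]
    rw [smul_comm]

theorem spinAction_apply (X : Module.End ℂ V) :
    spinAction e A A' X = (4 : ℂ)⁻¹ • ∑ i, A' (X (e i)) * A (e i) := rfl

theorem so_skew (X : so B) (u v : V) :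
    B ((X : Module.End ℂ V) u) v = -B u ((X : Module.End ℂ V) v) := by
  have := (LinearMap.mem_skewAdjointSubmodule (B := B) _).1 X.2 u v
  simpa using this

variable {e} [DecidableEq ι]

theorem sum_form_smul_map (he : ∀ i j, B (e i) (e j) = if i = j then 1 else 0) {W : Type*}
    [AddCommGroup W] [Module ℂ W] (f : V →ₗ[ℂ] W) (v : V) : ∑ i, B (e i) v • f (e i) = f v := by
  conv_rhs => rw [← e.sum_repr v]
  simp only [map_sum, map_smul, form_basis_eq_repr he]

/-- For skew `X` the tensor `∑ eᵢ ⊗ X eᵢ` is antisymmetric. -/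
theorem sum_map_so_swap (hB : B.IsSymm) (he : ∀ i j, B (e i) (e j) = if i = j then 1 else 0)
    {W : Type*} [AddCommGroup W] [Module ℂ W] (F : V →ₗ[ℂ] V →ₗ[ℂ] W) (X : so B) :
    ∑ i, F (e i) ((X : Module.End ℂ V) (e i)) = -∑ i, F ((X : Module.End ℂ V) (e i)) (e i) := by
  have h1 : ∀ i, F (e i) ((X : Module.End ℂ V) (e i))
      = ∑ j, B (e j) ((X : Module.End ℂ V) (e i)) • F (e i) (e j) := fun i =>
    (sum_form_smul_map he (F (e i)) _).symm
  have h2 : ∀ j, F ((X : Module.End ℂ V) (e j)) (e j)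
      = ∑ i, B (e i) ((X : Module.End ℂ V) (e j)) • F (e i) (e j) := fun j =>
    (sum_form_smul_map he (F.flip (e j)) _).symm
  simp only [h1, h2]
  rw [Finset.sum_comm, ← Finset.sum_neg_distrib]
  refine Finset.sum_congr rfl fun j _ => ?_
  rw [← Finset.sum_neg_distrib]
  refine Finset.sum_congr rfl fun i _ => ?_
  rw [hB.eq (e j), so_skew, neg_smul]

namespace IsCliffordPair

/-- Moving `v` past `X eᵢ` and then `eᵢ` leaves two contractions, each summing to a multiple of `X
v`. The pair `A, A'` is exchanged since `A v` reverses chirality. -/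
theorem mul_spinAction (h : IsCliffordPair B A A') (hB : B.IsSymm)
    (he : ∀ i j, B (e i) (e j) = if i = j then 1 else 0) (X : so B) (v : V) :
    A v * spinAction e A A' X = spinAction e A' A X * A v - A ((X : Module.End ℂ V) v) := by
  set X' : Module.End ℂ V := X.1 with hX
  have hi : ∀ i, A v * (A' (X' (e i)) * A (e i)) = A (X' (e i)) * A' (e i) * A v
      - (2 : ℂ) • (B (e i) (X' v) • A (e i)) - (2 : ℂ) • (B (e i) v • A (X' (e i))) := fun i => by
    have e1 := congrArg (· * A (e i)) (h.right v (X' (e i)))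
    have e2 := congrArg (A (X' (e i)) * ·) (h.left v (e i))
    simp only [add_mul, mul_add, mul_smul_comm, smul_mul_assoc, one_mul, mul_one] at e1 e2
    have e3 : B v (X' (e i)) = -B (e i) (X' v) := by
      rw [hB.eq (e i), hX, so_skew, neg_neg]
    rw [← mul_assoc, mul_assoc _ _ (A v)]
    rw [← eq_sub_iff_add_eq] at e1
    rw [← mul_assoc (A (X' (e i))), ← eq_sub_iff_add_eq] at e2
    rw [e1, e2, e3, hB.eq v]
    module
  rw [spinAction_apply, spinAction_apply, mul_smul_comm, smul_mul_assoc, Finset.mul_sum,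
    Finset.sum_mul]
  simp only [hi, Finset.sum_sub_distrib, ← Finset.smul_sum]
  have hAX := sum_form_smul_map he (A ∘ₗ X') v
  simp only [LinearMap.comp_apply] at hAX
  rw [sum_form_smul_map he A, hAX]
  module

theorem spinAction_mul (h : IsCliffordPair B A A') (hB : B.IsSymm)
    (he : ∀ i j, B (e i) (e j) = if i = j then 1 else 0) (X : so B) (u v : V) :
    spinAction e A A' X * (A' u * A v) - (A' u * A v) * spinAction e A A' X
      = A' ((X : Module.End ℂ V) u) * A v + A' u * A ((X : Module.End ℂ V) v) := by
  have h1 := congrArg (· * A v) (h.swap.mul_spinAction hB he X u)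
  have h2 := congrArg (A' u * ·) (h.mul_spinAction hB he X v)
  simp only [mul_sub, sub_mul, mul_assoc] at h1 h2 ⊢
  rw [h2, h1]
  abel

/-- By `spinAction_mul`, bracketing with `X` is a derivation on `∑ (Y eᵢ) eᵢ`; skewness turns the
term `∑ (Y eᵢ)(X eᵢ)` into `-∑ (Y X eᵢ) eᵢ`. -/
theorem spinAction_lie (h : IsCliffordPair B A A') (hB : B.IsSymm)
    (he : ∀ i j, B (e i) (e j) = if i = j then 1 else 0) (X Y : so B) :
    spinAction e A A' ((⁅X, Y⁆ : so B) : Module.End ℂ V)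
      = ⁅spinAction e A A' (X : Module.End ℂ V), spinAction e A A' (Y : Module.End ℂ V)⁆ := by
  rw [LieRing.of_associative_ring_bracket]
  conv_rhs => rw [spinAction_apply e (Y : Module.End ℂ V)]
  rw [mul_smul_comm, smul_mul_assoc, Finset.mul_sum, Finset.sum_mul, ← smul_sub,
    ← Finset.sum_sub_distrib]
  simp only [h.spinAction_mul hB he]
  rw [Finset.sum_add_distrib, spinAction_apply]
  have := sum_map_so_swap hB he
    (((LinearMap.mul ℂ (Module.End ℂ S)).compl₁₂ (A' ∘ₗ (Y : Module.End ℂ V)) A)) X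
  simp only [LinearMap.compl₁₂_apply, LinearMap.comp_apply, LinearMap.mul_apply'] at this
  rw [this, ← sub_eq_add_neg, ← Finset.sum_sub_distrib]
  simp [LieRing.of_associative_ring_bracket, sub_mul]

/-- The spin representation of `so(V)` attached to a Clifford pair. -/
noncomputable def spinRep (h : IsCliffordPair B A A') (hB : B.IsSymm)
    (he : ∀ i j, B (e i) (e j) = if i = j then 1 else 0) : so B →ₗ⁅ℂ⁆ Module.End ℂ S :=
  { (spinAction e A A').comp (so B).toSubmodule.subtype with
    map_lie' := fun {X Y} => h.spinAction_lie hB he X Y }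

end IsCliffordPair

variable [LieRingModule (so B) S] [LieModule ℂ (so B) S]

theorem cliffordAct_eq_mul (h : IsCliffordPair B A A') (hB : B.IsSymm)
    (he : ∀ i j, B (e i) (e j) = if i = j then 1 else 0)
    (hact : ∀ (X : so B) (s : S), ⁅X, s⁆ = spinAction e A A' X s) (v w : V) :
    cliffordAct B hB S v w = A' v * A w := by
  ext s
  rw [cliffordAct_apply, hact]
  have h1 : spinAction e A A' (wedge B hB v w : Module.End ℂ V)
      = (4 : ℂ)⁻¹ • (A' v * A w - A' w * A v) := by
    have e1 := sum_form_smul_map he ((LinearMap.mul ℂ (Module.End ℂ S) (A' v)) ∘ₗ A) w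
    have e2 := sum_form_smul_map he ((LinearMap.mul ℂ (Module.End ℂ S) (A' w)) ∘ₗ A) v
    simp only [LinearMap.comp_apply, LinearMap.mul_apply'] at e1 e2
    rw [spinAction_apply, ← e1, ← e2, ← Finset.sum_sub_distrib]
    simp only [wedge, LinearMap.sub_apply, LinearMap.smulRight_apply, map_sub, map_smul, sub_mul,
      smul_mul_assoc, hB.eq w, hB.eq v]
  have h2 := LinearMap.congr_fun (h.left v w) s
  simp only [LinearMap.add_apply, LinearMap.smul_apply, Module.End.one_apply] at h2
  have h3 : B v w • s = (2⁻¹ : ℂ) • ((2 * B v w) • s) := by module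
  rw [h1, h3, ← h2]
  simp only [LinearMap.smul_apply, LinearMap.sub_apply]
  module

end CliffordPair

/-! ### SUSY data from a unitary Clifford pair. -/

section Existence

variable {V : Type*} [AddCommGroup V] [Module ℂ V] {B : LinearMap.BilinForm ℂ V}
  {S : Type*} {ι : Type*} [Fintype ι] {e : Module.Basis ι ℂ V}

/-- If `A` and `A'` are mutually adjoint for a Hermitian inner product on `S`, orthogonal
complements of submodules are submodules. -/
theorem complementedLattice_lieSubmodule [NormedAddCommGroup S] [InnerProductSpace ℂ S]
    [FiniteDimensional ℂ S] {A A' : V →ₗ[ℂ] Module.End ℂ S} [LieRingModule (so B) S]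
    [LieModule ℂ (so B) S]
    (hact : ∀ (X : so B) (s : S), ⁅X, s⁆ = spinAction e A A' X s)
    (hstable : ∀ (N : LieSubmodule ℂ (so B) S) (v w : V), ∀ s ∈ N, A' v (A w s) ∈ N)
    (hadj : ∀ i x y, inner ℂ (A (e i) x) y = inner ℂ x (A' (e i) y)) :
    ComplementedLattice (LieSubmodule ℂ (so B) S) := by
  have hadj' : ∀ i x y, inner ℂ (A' (e i) x) y = inner ℂ x (A (e i) y) := fun i x y => by
    rw [← inner_conj_symm, ← hadj, inner_conj_symm]
  refine ⟨fun N => ⟨{ N.toSubmoduleᗮ with lie_mem := fun {X} {s} hs => ?_ }, ?_⟩⟩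
  · change s ∈ N.toSubmoduleᗮ at hs
    change _ ∈ N.toSubmoduleᗮ
    -- The Hermitian adjoint of `A' (e i) * A (e j)` is `A' (e j) * A (e i)`, which preserves `N`.
    have hbasis : ∀ i j, A' (e i) (A (e j) s) ∈ N.toSubmoduleᗮ := fun i j => by
      rw [Submodule.mem_orthogonal]
      intro u hu
      rw [← hadj, ← hadj']
      exact (Submodule.mem_orthogonal _ _).1 hs _ (hstable N _ _ _ hu)
    have hvec : ∀ v j, A' v (A (e j) s) ∈ N.toSubmoduleᗮ := fun v j => by
      rw [← e.sum_repr v]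
      simp only [map_sum, map_smul, LinearMap.sum_apply, LinearMap.smul_apply]
      exact sum_mem fun i _ => Submodule.smul_mem _ _ (hbasis i j)
    rw [hact, spinAction_apply]
    simp only [LinearMap.smul_apply, LinearMap.sum_apply, Module.End.mul_apply]
    exact Submodule.smul_mem _ _ (sum_mem fun j _ => hvec _ j)
  · rw [← LieSubmodule.isCompl_toSubmodule]
    exact Submodule.isCompl_orthogonal (𝕜 := ℂ) _

variable [AddCommGroup S] [Module ℂ S]

/-- The vector-valued pairing with components `g (A (e i) a) b` in the basis `e`. -/
noncomputable def spinPairing (e : Module.Basis ι ℂ V) (A : V →ₗ[ℂ] Module.End ℂ S)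
    (g : LinearMap.BilinForm ℂ S) : S →ₗ[ℂ] S →ₗ[ℂ] V :=
  ∑ i, (g ∘ₗ A (e i)).compr₂ (LinearMap.toSpanSingleton ℂ V (e i))

theorem spinPairing_apply (A : V →ₗ[ℂ] Module.End ℂ S) (g : LinearMap.BilinForm ℂ S) (a b : S) :
    spinPairing e A g a b = ∑ i, g (A (e i) a) b • e i := by
  simp [spinPairing, LinearMap.sum_apply]

variable [DecidableEq ι]

theorem form_spinPairing (he : ∀ i j, B (e i) (e j) = if i = j then 1 else 0)
    (A : V →ₗ[ℂ] Module.End ℂ S) (g : LinearMap.BilinForm ℂ S) (v : V) (a b : S) :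
    B v (spinPairing e A g a b) = g (A v a) b := by
  rw [← e.sum_repr v]
  simp only [spinPairing_apply, map_sum, map_smul, LinearMap.sum_apply, LinearMap.smul_apply, he,
    smul_eq_mul, mul_ite, mul_one, mul_zero, Finset.sum_ite_eq', Finset.mem_univ, if_true]
  exact Finset.sum_congr rfl fun i _ => mul_comm _ _

variable {A A' : V →ₗ[ℂ] Module.End ℂ S} {g : LinearMap.BilinForm ℂ S}

theorem spinPairing_equivariant (h : IsCliffordPair B A A') (hB : B.IsSymm)
    (he : ∀ i j, B (e i) (e j) = if i = j then 1 else 0)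
    (hA : ∀ v a b, g (A v a) b = g a (A v b)) (hA' : ∀ v a b, g (A' v a) b = g a (A' v b))
    (X : so B) (a b : S) :
    X.1 (spinPairing e A g a b) = spinPairing e A g (spinAction e A A' X.1 a) b
      + spinPairing e A g a (spinAction e A A' X.1 b) := by
  -- The `g`-transpose of the spin action is minus the action of opposite chirality, so
  -- `mul_spinAction` yields equivariance.
  have hdual : ∀ x y, g x (spinAction e A A' X.1 y) = -g (spinAction e A' A X.1 x) y := by
    intro x y
    have h1 := sum_map_so_swap hB he ((LinearMap.mul ℂ (Module.End ℂ S)).compl₁₂ A A') X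
    simp only [LinearMap.compl₁₂_apply, LinearMap.mul_apply'] at h1
    have h2 := congrArg (fun f => g (f x) y) h1
    simp only [LinearMap.sum_apply, LinearMap.neg_apply, map_sum, map_neg,
      Module.End.mul_apply] at h2
    rw [spinAction_apply, spinAction_apply]
    simp only [LinearMap.sum_apply, LinearMap.smul_apply, map_sum, map_smul, smul_eq_mul,
      Module.End.mul_apply, ← hA', ← hA, h2]
    ring
  refine sub_eq_zero.1 (eq_zero_of_form_basis_eq_zero he fun i => ?_)
  have hmul := LinearMap.congr_fun (h.mul_spinAction hB he X (e i)) a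
  simp only [Module.End.mul_apply, LinearMap.sub_apply] at hmul
  have hsk := so_skew X (e i) (spinPairing e A g a b)
  rw [form_spinPairing he] at hsk
  rw [map_sub, map_add, form_spinPairing he, form_spinPairing he, hdual, hmul, map_sub,
    LinearMap.sub_apply, hsk]
  ring

end Existence

/-- Unitarity `hadj` serves complete reducibility; `hone` makes `g` itself a component of the
pairing, so the pairing has zero kernel. -/
theorem exists_susyData_of_cliffordPair {V : Type*} [AddCommGroup V] [Module ℂ V]
    {B : LinearMap.BilinForm ℂ V} {ι : Type*} [Fintype ι] [DecidableEq ι] {e : Module.Basis ι ℂ V}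
    {S : Type} [NormedAddCommGroup S] [InnerProductSpace ℂ S] [FiniteDimensional ℂ S]
    [Nontrivial S] {A A' : V →ₗ[ℂ] Module.End ℂ S} {g : LinearMap.BilinForm ℂ S}
    (hB : B.IsSymm) (he : ∀ i j, B (e i) (e j) = if i = j then 1 else 0)
    (h : IsCliffordPair B A A') (hadj : ∀ i x y, inner ℂ (A (e i) x) y = inner ℂ x (A' (e i) y))
    (hg : ∀ a b, g a b = g b a) (hg0 : ∀ a, (∀ b, g a b = 0) → a = 0)
    (hA : ∀ v a b, g (A v a) b = g a (A v b)) (hA' : ∀ v a b, g (A' v a) b = g a (A' v b))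
    (hone : ∃ i, A (e i) = 1)
    (hF : ∀ a b c d, ∑ i, (g (A (e i) a) b * g (A (e i) c) d + g (A (e i) a) c * g (A (e i) b) d
      + g (A (e i) a) d * g (A (e i) b) c) = 0) :
    ∃ (S : Type) (_ : AddCommGroup S) (_ : Module ℂ S) (_ : Nontrivial S)
      (_ : LieRingModule (so B) S) (_ : LieModule ℂ (so B) S) (Γ : S →ₗ[ℂ] S →ₗ[ℂ] V),
      IsSUSYData B hB Γ ∧ FierzIdentity B Γ := by
  let _ : LieRingModule (so B) S := LieRingModule.compLieHom S (h.spinRep hB he)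
  have : LieModule ℂ (so B) S := LieModule.compLieHom S (h.spinRep hB he)
  have hact : ∀ (X : so B) (s : S), ⁅X, s⁆ = spinAction e A A' X s := fun X s => rfl
  have hcl : ∀ v w, cliffordAct B hB S v w = A' v * A w := cliffordAct_eq_mul h hB he hact
  have hsq : ∀ v, A v * A' v = B v v • 1 := fun v => by
    have := h.right v v
    rw [← two_smul ℂ, mul_smul] at this
    exact smul_right_injective _ two_ne_zero this
  have : ComplementedLattice (LieSubmodule ℂ (so B) S) := by
    refine complementedLattice_lieSubmodule hact (fun N v w s hs => ?_) hadj
    rw [← Module.End.mul_apply, ← hcl, cliffordAct_apply]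
    exact add_mem (N.smul_mem _ (N.lie_mem hs)) (N.smul_mem _ hs)
  refine ⟨S, inferInstance, inferInstance, inferInstance, inferInstance, inferInstance,
    spinPairing e A g, ⟨inferInstance, ?_, fun a b => ?_, fun X a b => ?_, fun a ha => ?_⟩,
    fun a b c d => ?_⟩
  · refine sSup_isSpinorRep_eq_top fun u v w => ?_
    rw [hcl, hcl, hcl, mul_assoc, ← mul_assoc (A v), hsq, smul_mul_assoc, one_mul, mul_smul_comm]
  · simp only [spinPairing_apply, hA, hg a]
  · exact spinPairing_equivariant h hB he hA hA' X a b
  · obtain ⟨i, hi⟩ := hone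
    refine hg0 a fun b => ?_
    have := congrArg (B (e i)) (ha b)
    rw [form_spinPairing he, hi, map_zero] at this
    exact this
  · rw [← sum_form_mul_form he, ← sum_form_mul_form he, ← sum_form_mul_form he,
      ← Finset.sum_add_distrib, ← Finset.sum_add_distrib, ← hF a b c d]
    simp only [form_spinPairing he]

/-! ### Composition algebras of dimension 1, 2, 4 and 8. -/

/-- The sign of the product of the octonion units `i` and `j`, read off from bit `j` of the `i`-th
entry of the table; up to this sign the product is the unit `i xor j`. -/
def octonionSign (i j : ℕ) : ℤ :=
  if ([0, 106, 198, 172, 30, 116, 216, 178].getD i 0).testBit j then -1 else 1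

/-- Structure constants of the Cayley–Dickson algebra of dimension `2 ^ m`, `m ≤ 3`. -/
def octonionTensor (m : ℕ) (z i j : Fin (2 ^ m)) : ℤ :=
  if z.val = i.val ^^^ j.val then octonionSign z i else 0

/-- The cancellation of cross terms behind the composition law. Dimension 8 covers the smaller ones,
as indices below `2 ^ m` are closed under xor. -/
theorem octonionSign_mul : ∀ i < 8, ∀ j < 8, ∀ k < 8,
    octonionSign (i ^^^ k) i * octonionSign (i ^^^ k) j
      + octonionSign (j ^^^ k) i * octonionSign (j ^^^ k) j = if i = j then 2 else 0 := by
  decide +kernel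

/-- Multiplicativity of the norm of the algebra, polarised. -/
theorem sum_octonionTensor {m : ℕ} (hm : m ≤ 3) (i j k l : Fin (2 ^ m)) :
    ∑ z, (octonionTensor m z i k * octonionTensor m z j l
      + octonionTensor m z i l * octonionTensor m z j k) = if i = j ∧ k = l then 2 else 0 := by
  have hpow : 2 ^ m ≤ 8 := (Nat.pow_le_pow_right (by norm_num) hm).trans (by norm_num)
  have hsum : ∀ i k j l : Fin (2 ^ m), ∑ z, octonionTensor m z i k * octonionTensor m z j l
      = if i.val ^^^ k.val = j.val ^^^ l.val then
          octonionSign (i.val ^^^ k.val) i * octonionSign (i.val ^^^ k.val) j else 0 := by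
    intro i k j l
    rw [Finset.sum_eq_single (⟨i.val ^^^ k.val, Nat.xor_lt_two_pow i.2 k.2⟩ : Fin (2 ^ m))]
    · simp [octonionTensor]
    · intro z _ hz
      have : z.val ≠ i.val ^^^ k.val := fun h => hz (Fin.ext h)
      simp [octonionTensor, this]
    · simp
  -- Both products in the polarised identity are supported on the same index quadruples.
  have hswap : (i.val ^^^ l.val = j.val ^^^ k.val) ↔ (i.val ^^^ k.val = j.val ^^^ l.val) := by
    rw [← Nat.xor_right_inj (x := k.val ^^^ l.val)]
    have e1 : k.val ^^^ l.val ^^^ (i.val ^^^ l.val) = i.val ^^^ k.val := by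
      rw [Nat.xor_comm i.val l.val, Nat.xor_assoc, Nat.xor_xor_cancel_left, Nat.xor_comm]
    have e2 : k.val ^^^ l.val ^^^ (j.val ^^^ k.val) = j.val ^^^ l.val := by
      rw [Nat.xor_comm k.val l.val, Nat.xor_comm j.val k.val, Nat.xor_assoc,
        Nat.xor_xor_cancel_left, Nat.xor_comm]
    rw [e1, e2]
  rw [Finset.sum_add_distrib, hsum, hsum]
  by_cases h : i.val ^^^ k.val = j.val ^^^ l.val
  · rw [if_pos h, if_pos (hswap.2 h), hswap.2 h,
      octonionSign_mul i (i.2.trans_le hpow) j (j.2.trans_le hpow) k (k.2.trans_le hpow)]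
    refine if_congr ⟨fun hij => ⟨Fin.ext hij, Fin.ext ?_⟩, fun hij => congrArg _ hij.1⟩ rfl rfl
    rw [hij] at h
    exact Nat.xor_right_injective h
  · rw [if_neg h, if_neg (fun h' => h (hswap.1 h')), if_neg]
    · rfl
    · rintro ⟨rfl, rfl⟩
      exact h rfl

/-! ### Gamma matrices and their Fierz identity. -/

section Matrices

open Matrix

variable {κ : Type*} [DecidableEq κ]

/-- The off-diagonal blocks of the gamma matrices of a composition algebra. -/
def gammaMatrix (L : κ → Matrix κ κ ℂ) : Option (Option κ) → Matrix (κ ⊕ κ) (κ ⊕ κ) ℂ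
  | none => 1
  | some none => Complex.I • fromBlocks 1 0 0 (-1)
  | some (some z) => Complex.I • fromBlocks 0 (L z) (L z)ᵀ 0

theorem gammaMatrix_transpose (L : κ → Matrix κ κ ℂ) (i : Option (Option κ)) :
    (gammaMatrix L i)ᵀ = gammaMatrix L i := by
  rcases i with _ | _ | z <;> simp [gammaMatrix, fromBlocks_transpose]

theorem fromBlocks_two : (2 : Matrix (κ ⊕ κ) (κ ⊕ κ) ℂ) = fromBlocks 2 0 0 2 := by
  rw [← one_add_one_eq_two, ← fromBlocks_one, fromBlocks_add]
  simp [one_add_one_eq_two]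

variable [Fintype κ]

/-- Each `N i` is orthogonal, and conjugating the relation by `N i` exchanges the order of the
factors. -/
theorem mul_transpose_add_of_transpose_mul_add {ι : Type*} [DecidableEq ι]
    (N : ι → Matrix κ κ ℂ)
    (h : ∀ i j, (N i)ᵀ * N j + (N j)ᵀ * N i = if i = j then 2 else 0) (i j : ι) :
    N i * (N j)ᵀ + N j * (N i)ᵀ = if i = j then 2 else 0 := by
  have hone : ∀ i, (N i)ᵀ * N i = 1 := fun i => by
    have := h i i
    rw [if_pos rfl, ← two_smul ℂ] at this
    refine smul_right_injective _ (two_ne_zero (α := ℂ)) (this.trans ?_)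
    simp only [two_smul]; exact one_add_one_eq_two.symm
  have hone' : ∀ i, N i * (N i)ᵀ = 1 := fun i => mul_eq_one_comm.1 (hone i)
  split_ifs with hij
  · subst hij
    rw [hone']; exact one_add_one_eq_two
  · have h1 := h i j
    rw [if_neg hij] at h1
    have h2 : N i * ((N i)ᵀ * N j + (N j)ᵀ * N i) * (N i)ᵀ = 0 := by rw [h1]; simp
    rw [mul_add, add_mul, ← mul_assoc, hone', one_mul, ← mul_assoc, mul_assoc _ (N i), hone',
      mul_one] at h2
    rw [add_comm, h2]

/-- A family of matrices `L z` whose coefficients are the structure constants of a composition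
algebra over `ℂ` with a real orthonormal basis. -/
structure IsComposition (L : κ → Matrix κ κ ℂ) : Prop where
  real : ∀ z, (L z).map star = L z
  norm : ∀ i j k l, ∑ z, (L z i k * L z j l + L z i l * L z j k) = if i = j ∧ k = l then 2 else 0

namespace IsComposition

variable {L : κ → Matrix κ κ ℂ}

/-- Slice the tensor along `i` instead of `z`: `norm` is a relation `Nᵀ N` for these slices, and the
entries of the reversed relation are those wanted for `L`. -/
theorem mul_transpose (h : IsComposition L) (z w : κ) :
    L z * (L w)ᵀ + L w * (L z)ᵀ = if z = w then 2 else 0 := by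
  have key := mul_transpose_add_of_transpose_mul_add (fun i => Matrix.of fun z k => L z i k)
    (fun i j => by
      ext k l
      have := h.norm i j k l
      rw [Finset.sum_add_distrib] at this
      simp only [Matrix.add_apply, mul_apply, transpose_apply, of_apply]
      rw [Finset.sum_congr rfl fun z _ => mul_comm (L z j k) _, this]
      by_cases hij : i = j <;> by_cases hkl : k = l <;> simp [hij, hkl, ofNat_apply])
  ext i j
  have := congrFun (congrFun (key i j) z) w
  simp only [Matrix.add_apply, mul_apply, transpose_apply, of_apply] at this ⊢
  rw [Finset.sum_congr rfl fun k _ => mul_comm (L w i k) _, this]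
  by_cases hij : i = j <;> by_cases hzw : z = w <;> simp [hij, hzw, ofNat_apply]

theorem transpose_mul (h : IsComposition L) (z w : κ) :
    (L z)ᵀ * L w + (L w)ᵀ * L z = if z = w then 2 else 0 := by
  have := mul_transpose_add_of_transpose_mul_add (fun z => (L z)ᵀ)
    (fun z w => by simpa using h.mul_transpose z w) z w
  simpa using this

end IsComposition

namespace IsComposition

variable {L : κ → Matrix κ κ ℂ}

theorem gammaMatrix_conjTranspose_mul (h : IsComposition L) (i j : Option (Option κ)) :
    (gammaMatrix L i)ᴴ * gammaMatrix L j + (gammaMatrix L j)ᴴ * gammaMatrix L i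
      = if i = j then 2 else 0 := by
  have hL : ∀ z, (L z)ᴴ = (L z)ᵀ := fun z => by
    rw [conjTranspose, transpose_map, h.real]
  have hL' : ∀ z, (L z)ᵀᴴ = L z := fun z => by
    rw [← hL, conjTranspose_conjTranspose]
  rcases i with _ | _ | z <;> rcases j with _ | _ | w <;>
    simp [gammaMatrix, fromBlocks_conjTranspose, fromBlocks_multiply, smul_smul, hL, hL',
      fromBlocks_add, ← fromBlocks_one, fromBlocks_two, one_add_one_eq_two, h.mul_transpose,
      h.transpose_mul, fromBlocks_smul]
  split_ifs <;> simp

/-- The polarisation of the norm identity. `L` enters only with two indices in each copy of `κ`; in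
every surviving pattern the total is a multiple of `1 + I² = 0`. -/
theorem sum_gammaMatrix (h : IsComposition L) (α β γ δ : κ ⊕ κ) :
    ∑ i, (gammaMatrix L i α β * gammaMatrix L i γ δ + gammaMatrix L i α γ * gammaMatrix L i β δ
      + gammaMatrix L i α δ * gammaMatrix L i β γ) = 0 := by
  have hI : Complex.I * Complex.I = -1 := Complex.I_mul_I
  have hS : ∀ (i j k l : κ) (f : κ → ℂ),
      (∀ z, f z = Complex.I * Complex.I * (L z i k * L z j l + L z i l * L z j k)) →
      ∑ z, f z = Complex.I * Complex.I
        * (2 * ((if i = j then 1 else 0) * if k = l then 1 else 0)) := by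
    intro i j k l f hf
    simp only [hf]
    rw [← Finset.mul_sum, h.norm]
    by_cases hij : i = j <;> by_cases hkl : k = l <;> simp [hij, hkl]
  simp only [Fintype.sum_option, gammaMatrix]
  rcases α with i | i <;> rcases β with j | j <;> rcases γ with k | k <;> rcases δ with l | l <;>
    simp only [Matrix.smul_apply, fromBlocks_apply₁₁, fromBlocks_apply₁₂, fromBlocks_apply₂₁,
      fromBlocks_apply₂₂, one_apply, Sum.inl.injEq, Sum.inr.injEq, reduceCtorEq, if_false,
      Matrix.neg_apply, Matrix.zero_apply, smul_eq_mul, transpose_apply, mul_zero, zero_mul,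
      add_zero, zero_add, Finset.sum_const_zero]
  case inl.inl.inr.inr =>
    rw [hS i j k l]
    · linear_combination ((if i = j then 1 else 0) * if k = l then 1 else 0) * hI
    · exact fun z => by ring
  case inl.inr.inl.inr =>
    rw [hS i k j l]
    · linear_combination ((if i = k then 1 else 0) * if j = l then 1 else 0) * hI
    · exact fun z => by ring
  case inl.inr.inr.inl =>
    rw [hS i l j k]
    · linear_combination ((if i = l then 1 else 0) * if j = k then 1 else 0) * hI
    · exact fun z => by ring
  case inr.inl.inl.inr =>
    rw [hS j k i l]
    · linear_combination ((if j = k then 1 else 0) * if i = l then 1 else 0) * hI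
    · exact fun z => by ring
  case inr.inl.inr.inl =>
    rw [hS j l i k]
    · linear_combination ((if j = l then 1 else 0) * if i = k then 1 else 0) * hI
    · exact fun z => by ring
  case inr.inr.inl.inl =>
    rw [hS k l i j]
    · linear_combination ((if k = l then 1 else 0) * if i = j then 1 else 0) * hI
    · exact fun z => by ring
  all_goals
    linear_combination (((if i = j then 1 else 0) * if k = l then 1 else 0)
      + ((if i = k then 1 else 0) * if j = l then 1 else 0)
      + ((if i = l then 1 else 0) * if j = k then 1 else 0)) * hI

end IsComposition

end Matrices

/-! ### From matrix entries to vectors. -/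

section DotForm

variable {n : Type*} [Fintype n]

/-- The complex-bilinear dot product on `ℂⁿ`. -/
noncomputable def dotForm (n : Type*) [Fintype n] : LinearMap.BilinForm ℂ (EuclideanSpace ℂ n) :=
  LinearMap.mk₂ ℂ (fun a b => a.ofLp ⬝ᵥ b.ofLp) (fun a b c => by simp [add_dotProduct])
    (fun r a b => by simp) (fun a b c => by simp [dotProduct_add]) (fun r a b => by simp)

theorem dotForm_apply (a b : EuclideanSpace ℂ n) : dotForm n a b = a.ofLp ⬝ᵥ b.ofLp := rfl

variable [DecidableEq n]

theorem dotForm_toEuclideanLin {M : Matrix n n ℂ} (hM : M.transpose = M)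
    (a b : EuclideanSpace ℂ n) :
    dotForm n (M.toEuclideanLin a) b = dotForm n a (M.toEuclideanLin b) := by
  simp only [dotForm_apply, Matrix.ofLp_toLpLin, Matrix.toLin'_apply]
  rw [Matrix.dotProduct_mulVec, ← Matrix.mulVec_transpose, hM]

theorem dotForm_toEuclideanLin_single (M : Matrix n n ℂ) (i j : n) :
    dotForm n (M.toEuclideanLin (EuclideanSpace.single j 1)) (EuclideanSpace.single i 1)
      = M i j := by
  simp [dotForm_apply]

/-- A Fierz identity between symmetric matrices holds for all vectors. -/
theorem sum_dotForm_toEuclideanLin {ι : Type*} [Fintype ι] (M : ι → Matrix n n ℂ)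
    (hM : ∀ i, (M i).transpose = M i)
    (h : ∀ α β γ δ, ∑ i, (M i α β * M i γ δ + M i α γ * M i β δ + M i α δ * M i β γ) = 0)
    (a b c d : EuclideanSpace ℂ n) :
    ∑ i, (dotForm n ((M i).toEuclideanLin a) b * dotForm n ((M i).toEuclideanLin c) d
      + dotForm n ((M i).toEuclideanLin a) c * dotForm n ((M i).toEuclideanLin b) d
      + dotForm n ((M i).toEuclideanLin a) d * dotForm n ((M i).toEuclideanLin b) c) = 0 := by
  have hind : ∀ p : EuclideanSpace ℂ n → Prop, (∀ i, p (EuclideanSpace.single i 1)) → p 0 →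
      (∀ x y, p x → p y → p (x + y)) → (∀ (r : ℂ) x, p x → p (r • x)) → ∀ x, p x := by
    intro p h1 h0 hadd hsmul x
    have hx : x ∈ Submodule.span ℂ (Set.range (EuclideanSpace.basisFun n ℂ).toBasis) := by
      rw [Module.Basis.span_eq]; trivial
    induction hx using Submodule.span_induction with
    | mem x hx =>
      obtain ⟨i, rfl⟩ := hx
      simpa using h1 i
    | zero => exact h0
    | add x y _ _ hx hy => exact hadd x y hx hy
    | smul r x _ hx => exact hsmul r x hx
  set G : EuclideanSpace ℂ n → EuclideanSpace ℂ n → EuclideanSpace ℂ n → EuclideanSpace ℂ n → ℂ :=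
    fun a b c d =>
      ∑ i, (dotForm n ((M i).toEuclideanLin a) b * dotForm n ((M i).toEuclideanLin c) d
      + dotForm n ((M i).toEuclideanLin a) c * dotForm n ((M i).toEuclideanLin b) d
      + dotForm n ((M i).toEuclideanLin a) d * dotForm n ((M i).toEuclideanLin b) c) with hG
  have hswap₁ : ∀ a b c d, G a b c d = G b a c d := fun a b c d =>
    Finset.sum_congr rfl fun i _ => by
      rw [dotForm_toEuclideanLin (hM i) a b, show ∀ x y, dotForm n x y = dotForm n y x from
        fun x y => dotProduct_comm _ _]
      ring
  have hswap₂ : ∀ a b c d, G a b c d = G a c b d := fun a b c d =>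
    Finset.sum_congr rfl fun i _ => by
      rw [dotForm_toEuclideanLin (hM i) b c, show dotForm n b ((M i).toEuclideanLin c)
        = dotForm n ((M i).toEuclideanLin c) b from dotProduct_comm _ _]
      ring
  have hswap₃ : ∀ a b c d, G a b c d = G a b d c := fun a b c d =>
    Finset.sum_congr rfl fun i _ => by
      rw [dotForm_toEuclideanLin (hM i) c d, show dotForm n c ((M i).toEuclideanLin d)
        = dotForm n ((M i).toEuclideanLin d) c from dotProduct_comm _ _]
      ring
  have hzero : ∀ b c d, G 0 b c d = 0 := fun b c d => by simp [hG]
  have hadd : ∀ x y b c d, G (x + y) b c d = G x b c d + G y b c d := fun x y b c d => by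
    simp only [hG, map_add, LinearMap.add_apply, ← Finset.sum_add_distrib]
    exact Finset.sum_congr rfl fun i _ => by ring
  have hsmul : ∀ (r : ℂ) x b c d, G (r • x) b c d = r * G x b c d := fun r x b c d => by
    simp only [hG, map_smul, LinearMap.smul_apply, smul_eq_mul, Finset.mul_sum]
    exact Finset.sum_congr rfl fun i _ => by ring
  -- `G` is symmetric in all four arguments, so linearity in the first reduces each in turn to basis
  -- vectors.
  have hfirst : ∀ b c d, (∀ i, G (EuclideanSpace.single i 1) b c d = 0) → ∀ a, G a b c d = 0 :=
    fun b c d hi => hind _ hi (hzero b c d) (fun x y hx hy => by rw [hadd, hx, hy, add_zero])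
      (fun r x hx => by rw [hsmul, hx, mul_zero])
  refine hfirst b c d (fun α => ?_) a
  rw [hswap₁]
  refine hfirst _ c d (fun β => ?_) b
  rw [hswap₂, hswap₁]
  refine hfirst _ _ d (fun γ => ?_) c
  rw [hswap₃, hswap₂, hswap₁]
  refine hfirst _ _ _ (fun δ => ?_) d
  simp only [hG, dotForm_toEuclideanLin_single]
  rw [← h δ γ β α]
  have hM' : ∀ i x y, M i x y = M i y x := fun i x y => congrFun (congrFun (hM i) y) x
  refine Finset.sum_congr rfl fun i _ => ?_
  simp only [hM' i α, hM' i β γ, hM' i β δ, hM' i γ δ]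

end DotForm

/-! ### Assembling the examples. -/

theorem isCliffordPair_of_basis {V : Type*} [AddCommGroup V] [Module ℂ V]
    {B : LinearMap.BilinForm ℂ V} {S : Type*} [AddCommGroup S] [Module ℂ S] {ι : Type*}
    (e : Module.Basis ι ℂ V) {A A' : V →ₗ[ℂ] Module.End ℂ S}
    (hl : ∀ i j, A' (e i) * A (e j) + A' (e j) * A (e i) = (2 * B (e i) (e j)) • 1)
    (hr : ∀ i j, A (e i) * A' (e j) + A (e j) * A' (e i) = (2 * B (e i) (e j)) • 1) :
    IsCliffordPair B A A' := by
  have key : ∀ A A' : V →ₗ[ℂ] Module.End ℂ S,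
      (∀ i j, A' (e i) * A (e j) + A' (e j) * A (e i) = (2 * B (e i) (e j)) • 1) →
      ∀ u v, A' u * A v + A' v * A u = (2 * B u v) • 1 := by
    intro A A' h u v
    let P := (LinearMap.mul ℂ (Module.End ℂ S)).compl₁₂ A' A
    have : P + P.flip = (2 : ℂ) • B.compr₂ (LinearMap.toSpanSingleton ℂ (Module.End ℂ S) 1) :=
      LinearMap.ext_basis e e fun i j => by simpa [P, mul_smul] using h i j
    simpa [P, mul_smul] using LinearMap.congr_fun₂ this u v
  exact ⟨key A A' hl, key A' A hr⟩

theorem isComposition_octonionTensor {m : ℕ} (hm : m ≤ 3) :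
    IsComposition fun z : Fin (2 ^ m) =>
      Matrix.of fun i k => (octonionTensor m z i k : ℂ) := by
  refine ⟨fun z => ?_, fun i j k l => ?_⟩
  · ext i k
    simp
  · have := congrArg (Int.cast : ℤ → ℂ) (sum_octonionTensor hm i j k l)
    push_cast at this
    simpa using this

theorem IsComposition.exists_susyData {V : Type*} [AddCommGroup V] [Module ℂ V]
    {B : LinearMap.BilinForm ℂ V} {κ : Type} [Fintype κ] [DecidableEq κ] [Nonempty κ]
    {L : κ → Matrix κ κ ℂ} (h : IsComposition L) (hB : B.IsSymm)
    {e : Module.Basis (Option (Option κ)) ℂ V}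
    (he : ∀ i j, B (e i) (e j) = if i = j then 1 else 0) :
    ∃ (S : Type) (_ : AddCommGroup S) (_ : Module ℂ S) (_ : Nontrivial S)
      (_ : LieRingModule (so B) S) (_ : LieModule ℂ (so B) S) (Γ : S →ₗ[ℂ] S →ₗ[ℂ] V),
      IsSUSYData B hB Γ ∧ FierzIdentity B Γ := by
  let A : V →ₗ[ℂ] Module.End ℂ (EuclideanSpace ℂ (κ ⊕ κ)) :=
    e.constr ℂ fun i => (gammaMatrix L i).toEuclideanLin
  let A' : V →ₗ[ℂ] Module.End ℂ (EuclideanSpace ℂ (κ ⊕ κ)) :=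
    e.constr ℂ fun i => (gammaMatrix L i).conjTranspose.toEuclideanLin
  have hA : ∀ i, A (e i) = (gammaMatrix L i).toEuclideanLin := e.constr_basis ℂ _
  have hA' : ∀ i, A' (e i) = (gammaMatrix L i).conjTranspose.toEuclideanLin :=
    e.constr_basis ℂ _
  have hsymm : ∀ i, (gammaMatrix L i).conjTranspose.transpose
      = (gammaMatrix L i).conjTranspose := fun i => by
    rw [Matrix.conjTranspose, gammaMatrix_transpose, ← Matrix.transpose_map,
      gammaMatrix_transpose]
  have hmul : ∀ M N : Matrix (κ ⊕ κ) (κ ⊕ κ) ℂ,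
      (M.toEuclideanLin * N.toEuclideanLin : Module.End ℂ (EuclideanSpace ℂ (κ ⊕ κ)))
        = (M * N).toEuclideanLin := fun M N => (Matrix.toLpLin_mul_same 2 M N).symm
  have hone : (Matrix.toEuclideanLin (1 : Matrix (κ ⊕ κ) (κ ⊕ κ) ℂ)
      : Module.End ℂ (EuclideanSpace ℂ (κ ⊕ κ))) = 1 := Matrix.toLpLin_one 2
  have htwo : ∀ i j, Matrix.toEuclideanLin (if i = j then (2 : Matrix (κ ⊕ κ) (κ ⊕ κ) ℂ) else 0)
      = (2 * B (e i) (e j)) • (1 : Module.End ℂ (EuclideanSpace ℂ (κ ⊕ κ))) := fun i j => by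
    rw [he]
    split_ifs
    · have h2 : (2 : Matrix (κ ⊕ κ) (κ ⊕ κ) ℂ) = (2 : ℂ) • 1 := by
        rw [two_smul, one_add_one_eq_two]
      rw [h2, map_smul, hone, mul_one]
    · simp
  -- The gamma matrices are symmetric, so transposing the left Clifford relation gives the right
  -- one.
  have hright : ∀ i j, gammaMatrix L i * (gammaMatrix L j).conjTranspose
      + gammaMatrix L j * (gammaMatrix L i).conjTranspose = if i = j then 2 else 0 := fun i j => by
    have := congrArg Matrix.transpose (h.gammaMatrix_conjTranspose_mul j i)
    rw [Matrix.transpose_add, Matrix.transpose_mul, Matrix.transpose_mul, hsymm, hsymm,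
      gammaMatrix_transpose, gammaMatrix_transpose] at this
    rw [this]
    by_cases hij : i = j
    · rw [if_pos hij, if_pos hij.symm, Matrix.transpose_ofNat]
    · rw [if_neg hij, if_neg (Ne.symm hij), Matrix.transpose_zero]
  have hpair : IsCliffordPair B A A' := by
    refine isCliffordPair_of_basis e (fun i j => ?_) (fun i j => ?_)
    · rw [hA, hA, hA', hA', hmul, hmul, ← map_add, h.gammaMatrix_conjTranspose_mul, htwo]
    · rw [hA, hA, hA', hA', hmul, hmul, ← map_add, hright, htwo]
  have hself : ∀ (C : V →ₗ[ℂ] Module.End ℂ (EuclideanSpace ℂ (κ ⊕ κ))),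
      (∀ i a b, dotForm _ (C (e i) a) b = dotForm _ a (C (e i) b)) →
      ∀ v a b, dotForm _ (C v a) b = dotForm _ a (C v b) := fun C hC v a b => by
    rw [← e.sum_repr v]
    simp only [map_sum, map_smul, LinearMap.sum_apply, LinearMap.smul_apply, hC]
  refine exists_susyData_of_cliffordPair (g := dotForm (κ ⊕ κ)) hB he hpair (fun i x y => ?_)
    (fun a b => dotProduct_comm _ _) (fun a ha => ?_)
    (hself A fun i a b => by rw [hA, dotForm_toEuclideanLin (gammaMatrix_transpose L i)])
    (hself A' fun i a b => by rw [hA', dotForm_toEuclideanLin (hsymm i)])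
    ⟨none, by rw [hA]; exact hone⟩ ?_
  · rw [hA, hA', Matrix.toEuclideanLin_conjTranspose_eq_adjoint, LinearMap.adjoint_inner_right]
  · ext i
    have := ha (EuclideanSpace.single i 1)
    simpa [dotForm_apply] using this
  · simp only [hA]
    exact sum_dotForm_toEuclideanLin _ (gammaMatrix_transpose L) h.sum_gammaMatrix

theorem exists_susyData {V : Type*} [AddCommGroup V] [Module ℂ V] [FiniteDimensional ℂ V]
    {B : LinearMap.BilinForm ℂ V} (hB : B.IsSymm) (hnondeg : B.Nondegenerate) {m : ℕ} (hm : m ≤ 3)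
    (hdim : Module.finrank ℂ V = 2 ^ m + 2) :
    ∃ (S : Type) (_ : AddCommGroup S) (_ : Module ℂ S) (_ : Nontrivial S)
      (_ : LieRingModule (so B) S) (_ : LieModule ℂ (so B) S) (Γ : S →ₗ[ℂ] S →ₗ[ℂ] V),
      IsSUSYData B hB Γ ∧ FierzIdentity B Γ := by
  obtain ⟨e, he⟩ := exists_orthonormal_basis hB hnondeg (ι := Option (Option (Fin (2 ^ m))))
    (by simp [hdim])
  exact (isComposition_octonionTensor hm).exists_susyData hB he

end SUSY

theorem propositionE {V : Type*} [AddCommGroup V] [Module ℂ V] [FiniteDimensional ℂ V]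
    (B : LinearMap.BilinForm ℂ V) (hsymm : B.IsSymm) (hnondeg : B.Nondegenerate)
    (hdim : Module.finrank ℂ V ≠ 2) :
    (∀ (S : Type*) [AddCommGroup S] [Module ℂ S] [Nontrivial S]
        [LieRingModule (SUSY.so B) S] [LieModule ℂ (SUSY.so B) S] (Γ : S →ₗ[ℂ] S →ₗ[ℂ] V),
        SUSY.IsSUSYData B hsymm Γ → SUSY.FierzIdentity B Γ →
          SUSY.IsIrreducibleData B Γ ∧ Module.finrank ℂ V ∈ ({3, 4, 6, 10} : Set ℕ)) ∧
    (Module.finrank ℂ V ∈ ({3, 4, 6, 10} : Set ℕ) →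
      ∃ (S : Type) (_ : AddCommGroup S) (_ : Module ℂ S) (_ : Nontrivial S)
        (_ : LieRingModule (SUSY.so B) S) (_ : LieModule ℂ (SUSY.so B) S)
        (Γ : S →ₗ[ℂ] S →ₗ[ℂ] V),
        SUSY.IsSUSYData B hsymm Γ ∧ SUSY.FierzIdentity B Γ) := by
  refine ⟨fun S _ _ _ _ _ Γ h hF => h.irreducible_and_dim_mem hnondeg hdim hF, fun hmem => ?_⟩
  obtain ⟨m, hm, hd⟩ : ∃ m ≤ 3, Module.finrank ℂ V = 2 ^ m + 2 := by
    rcases hmem with h | h | h | h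
    · exact ⟨0, by norm_num, h⟩
    · exact ⟨1, by norm_num, h⟩
    · exact ⟨2, by norm_num, h⟩
    · exact ⟨3, by norm_num, h⟩
  exact SUSY.exists_susyData hsymm hnondeg hm hd
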